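/- Let $k$ be a field of characteristic zero, let $t\ge 1$, and let $G(-)$ be one of $\mathrm{GL}_t(-)$, $\mathrm{SL}_t(-)$, $\mathrm{O}_t(-)=\{M: M^{\mathrm{tr}}M=I\}$, or (for even $t$) $\mathrm{Sp}_t(-)=\{M: M^{\mathrm{tr}}\Omega M=\Omega\}$ with $\Omega=\begin{pmatrix}0&I\\-I&0\end{pmatrix}$. Let $C=G(\mathbb C)\cap \mathrm U_t(\mathbb C)$, a compact group, with its Haar measure normalised to have total mass $1$. For an action of $G(k)$ on a polynomial ring $S$ over $k$, a Reynolds operator is a $k$-linear map $\mathcal R\colon S\to S^{G(k)}$ with $\mathcal R(r)=r$ for all $r\in S^{G(k)}$ and $\mathcal R(g(s))=\mathcal R(s)$ for all $g\in G(k)$, $s\in S$. (1) Let $n\ge 1$, let $Y$ be a $t\times n$ matrix of indeterminates, and let $M\in G(k)$ act on $k[Y]$ by $Y\mapsto MY$. Let $U$ be a $t\times t$ matrix of new indeterminates, let $\phi\colon k[Y]\to k[Y][U]$ be the $k$-algebra map $Y\mapsto UY$, and for $f\in k[Y]$ write $\phi(f)=\sum_I\alpha_I(f)\,u^I$ with $\alpha_I(f)\in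 k[Y]$. Interpret each monomial $u^I$ as a function $C\to\mathbb C$. Then every integral $\int_C u^I$ is a rational number, hence may be regarded as an element of $k$; there is a unique Reynolds operator $\mathcal R\colon k[Y]\to k[Y]^{G(k)}$; and $$\mathcal R(f)=\sum_I \alpha_I(f)\int_C u^I\qquad\text{for all } f\in k[Y].$$ (2) Let $m,n\ge 1$, let $X$ and $Y$ be $m\times t$ and $t\times n$ matrices of indeterminates, and let $M\in G(k)$ act on $k[X,Y]$ by $X\mapsto XM^{-1}$, $Y\mapsto MY$. Let $U,\overline U$ be two $t\times t$ matrices of new independent indeterminates, let $\phi\colon k[X,Y]\to k[X,Y][U,\overline U]$ be the $k$-algebra map $X\mapsto X\overline U^{\mathrm{tr}}$, $Y\mapsto UY$, and for $f\in k[X,Y]$ write $\phi(f)=\sum_{I,J}\alpha_{I,J}(f)\,u^I\overline u^J$ with $\alpha_{I,J}(f)\in k[X,Y]$. Interpret $u^I\overline u^J$ as a function $C\to\mathbb C$, with $\overline u_{ij}$ the complex conjugate of $u_{ij}$. Then every integral $\int_C u^I\overline u^J$ is a rational number, hence may be regarded as an element of $k$; there is a unique Reynolds operator $\mathcal R\colon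 k[X,Y]\to k[X,Y]^{G(k)}$; and $$\mathcal R(f)=\sum_{I,J}\alpha_{I,J}(f)\int_C u^I\overline u^J\qquad\text{for all } f\in k[X,Y].$$ -/

import Mathlib

open MeasureTheory

noncomputable section

namespace ReynoldsClassical

/-! ### The classical groups and their compact forms -/

/-- The four families of classical groups. -/
inductive Family where
  | general
  | special
  | orthogonal
  | symplectic

/-- The group of all invertible matrices `M` with `Mᵗ B M = B`. -/
def isometryGroup {t : ℕ} {k : Type*} [Field k] (B : Matrix (Fin t) (Fin t) k) :
    Subgroup (GL (Fin t) k) where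
  carrier := {M | (M : Matrix (Fin t) (Fin t) k).transpose * B * M = B}
  one_mem' := by simp
  mul_mem' := by
    intro M N hM hN
    simp only [Set.mem_ofPred_eq] at hM hN ⊢
    calc ((M * N : GL (Fin t) k) : Matrix (Fin t) (Fin t) k).transpose * B * (M * N : GL (Fin t) k)
        = (N : Matrix (Fin t) (Fin t) k).transpose
            * ((M : Matrix (Fin t) (Fin t) k).transpose * B * M) * N := by
          simp [Matrix.transpose_mul, Matrix.mul_assoc]
      _ = B := by rw [hM, hN]
  inv_mem' := by
    intro M hM
    simp only [Set.mem_ofPred_eq] at hM ⊢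
    have h1 : (M : Matrix (Fin t) (Fin t) k) * ((M⁻¹ : GL (Fin t) k) : Matrix _ _ k) = 1 :=
      M.mul_inv
    have h2 : ((M⁻¹ : GL (Fin t) k) : Matrix (Fin t) (Fin t) k).transpose
        * (M : Matrix (Fin t) (Fin t) k).transpose = 1 := by
      rw [← Matrix.transpose_mul, h1, Matrix.transpose_one]
    calc ((M⁻¹ : GL (Fin t) k) : Matrix (Fin t) (Fin t) k).transpose * B
            * ((M⁻¹ : GL (Fin t) k) : Matrix (Fin t) (Fin t) k)
        = ((M⁻¹ : GL (Fin t) k) : Matrix (Fin t) (Fin t) k).transpose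
            * ((M : Matrix (Fin t) (Fin t) k).transpose * B * M)
            * ((M⁻¹ : GL (Fin t) k) : Matrix (Fin t) (Fin t) k) := by rw [hM]
      _ = (((M⁻¹ : GL (Fin t) k) : Matrix (Fin t) (Fin t) k).transpose
            * (M : Matrix (Fin t) (Fin t) k).transpose) * B
            * ((M : Matrix (Fin t) (Fin t) k)
            * ((M⁻¹ : GL (Fin t) k) : Matrix (Fin t) (Fin t) k)) := by
          simp only [Matrix.mul_assoc]
      _ = B := by rw [h1, h2, Matrix.one_mul, Matrix.mul_one]

/-- For even `t = 2 l`, the block matrix `[[0, I_l], [-I_l, 0]]`. -/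
def omega (t : ℕ) (k : Type*) [Field k] : Matrix (Fin t) (Fin t) k :=
  Matrix.of fun i j =>
    if (j : ℕ) = i + t / 2 then 1 else if (i : ℕ) = j + t / 2 then -1 else 0

/-- The classical group `G(k)`: one of `GL_t(k)`, `SL_t(k)`, `O_t(k)`, and, for even `t`,
`Sp_t(k)`. -/
def classicalGroup (F : Family) (t : ℕ) (k : Type*) [Field k] : Subgroup (GL (Fin t) k) :=
  match F with
  | .general => ⊤
  | .special => (Matrix.GeneralLinearGroup.det : GL (Fin t) k →* kˣ).ker
  | .orthogonal => isometryGroup 1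
  | .symplectic => isometryGroup (omega t k)

/-- The compact group `C = G(ℂ) ∩ U_t(ℂ)`, as a subgroup of the unitary group. -/
def compactForm (F : Family) (t : ℕ) : Subgroup (Matrix.unitaryGroup (Fin t) ℂ) :=
  (classicalGroup F t ℂ).comap
    (Unitary.toUnits : unitary (Matrix (Fin t) (Fin t) ℂ) →* (Matrix (Fin t) (Fin t) ℂ)ˣ)

/-- The matrix entries of an element of `C`. -/
def entry {F : Family} {t : ℕ} (g : compactForm F t) (i j : Fin t) : ℂ :=
  ((g : Matrix.unitaryGroup (Fin t) ℂ) : Matrix (Fin t) (Fin t) ℂ) i j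

theorem isClosed_isometry {t : ℕ} (B : Matrix (Fin t) (Fin t) ℂ) :
    IsClosed (((isometryGroup B).comap
      (Unitary.toUnits : unitary (Matrix (Fin t) (Fin t) ℂ) →* (Matrix (Fin t) (Fin t) ℂ)ˣ) :
        Subgroup (Matrix.unitaryGroup (Fin t) ℂ)) : Set (Matrix.unitaryGroup (Fin t) ℂ)) := by
  have : (((isometryGroup B).comap
      (Unitary.toUnits : unitary (Matrix (Fin t) (Fin t) ℂ) →* (Matrix (Fin t) (Fin t) ℂ)ˣ) :
        Subgroup (Matrix.unitaryGroup (Fin t) ℂ)) : Set (Matrix.unitaryGroup (Fin t) ℂ)) =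
      {g : Matrix.unitaryGroup (Fin t) ℂ |
        (g : Matrix (Fin t) (Fin t) ℂ).transpose * B * (g : Matrix (Fin t) (Fin t) ℂ) = B} :=
    rfl
  rw [this]
  exact isClosed_eq (by fun_prop) continuous_const

theorem isClosed_compactForm (F : Family) (t : ℕ) :
    IsClosed (compactForm F t : Set (Matrix.unitaryGroup (Fin t) ℂ)) := by
  cases F with
  | general =>
    have : (compactForm Family.general t : Set (Matrix.unitaryGroup (Fin t) ℂ)) = Set.univ := by
      ext; simp [compactForm, classicalGroup]
    rw [this]; exact isClosed_univ
  | special =>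
    have : (compactForm Family.special t : Set (Matrix.unitaryGroup (Fin t) ℂ)) =
        {g : Matrix.unitaryGroup (Fin t) ℂ | (g : Matrix (Fin t) (Fin t) ℂ).det = 1} := by
      ext g
      simp only [compactForm, classicalGroup, SetLike.mem_coe, Subgroup.mem_comap,
        MonoidHom.mem_ker, Set.mem_ofPred_eq, Units.ext_iff]
      rfl
    rw [this]
    exact isClosed_eq (by fun_prop) continuous_const
  | orthogonal => exact isClosed_isometry 1
  | symplectic => exact isClosed_isometry (omega t ℂ)

instance unitaryGroup_compactSpace (t : ℕ) : CompactSpace (Matrix.unitaryGroup (Fin t) ℂ) := by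
  refine isCompact_iff_compactSpace.mp ?_
  have hK : IsCompact {A : Matrix (Fin t) (Fin t) ℂ | ∀ i, A i ∈
      {v : Fin t → ℂ | ∀ j, v j ∈ Metric.closedBall (0 : ℂ) 1}} :=
    isCompact_pi_infinite fun _ => isCompact_pi_infinite fun _ => isCompact_closedBall _ _
  refine hK.of_isClosed_subset (isClosed_unitary (R := Matrix (Fin t) (Fin t) ℂ)) ?_
  intro U hU i j
  simpa using entry_norm_bound_of_unitary hU i j

instance compactForm_compactSpace (F : Family) (t : ℕ) : CompactSpace (compactForm F t) :=
  isCompact_iff_compactSpace.mp (isClosed_compactForm F t).isCompact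

instance compactForm_measurableSpace (F : Family) (t : ℕ) : MeasurableSpace (compactForm F t) :=
  borel _

instance compactForm_borelSpace (F : Family) (t : ℕ) : BorelSpace (compactForm F t) := ⟨rfl⟩

/-- The Haar measure of `C`, normalised to have total mass one. -/
def haarC (F : Family) (t : ℕ) : Measure (compactForm F t) :=
  Measure.haarMeasure ⊤

/-- The integral over `C` of the monomial `u^I`. -/
def monomialIntegral (F : Family) (t : ℕ) (I : Fin t × Fin t →₀ ℕ) : ℂ :=
  ∫ g, ∏ p, entry g p.1 p.2 ^ I p ∂(haarC F t)

/-- The integral over `C` of the monomial `u^I ū^J`, where the multi-index `(I, J)` is recorded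
as one multi-index `K` on the disjoint union of the two sets of variables. -/
def mixedMonomialIntegral (F : Family) (t : ℕ)
    (K : (Fin t × Fin t) ⊕ (Fin t × Fin t) →₀ ℕ) : ℂ :=
  ∫ g, (∏ p, entry g p.1 p.2 ^ K (Sum.inl p)) *
    (∏ p, (starRingEnd ℂ) (entry g p.1 p.2) ^ K (Sum.inr p)) ∂(haarC F t)

/-! ### Invariants and Reynolds operators -/

section Invariants

variable {k S G : Type*} [Field k] [CommRing S] [Algebra k S]

/-- The subalgebra `S^G` of elements fixed by a family of `k`-algebra endomorphisms of `S`. -/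
def invariants (act : G → S →ₐ[k] S) : Subalgebra k S :=
  ⨅ g, AlgHom.equalizer (act g) (AlgHom.id k S)

theorem mem_invariants (act : G → S →ₐ[k] S) (f : S) :
    f ∈ invariants act ↔ ∀ g, act g f = f := by
  simp [invariants, Algebra.mem_iInf, AlgHom.mem_equalizer]

/-- A Reynolds operator: a `k`-linear, `G`-equivariant splitting of `S^G ⊆ S`. -/
structure IsReynoldsOperator (act : G → S →ₐ[k] S) (R : S →ₗ[k] invariants act) : Prop where
  splitting : ∀ r : invariants act, R (r : S) = r
  equivariant : ∀ (g : G) (s : S), R (act g s) = R s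

end Invariants

/-! ### Copies of the standard representation -/

section Standard

variable (t n : ℕ) (k : Type*) [Field k]

/-- The polynomial ring `k[Y]` for a `t × n` matrix `Y` of indeterminates. -/
abbrev PolyY := MvPolynomial (Fin t × Fin n) k

variable {k} in
/-- The action `Y ↦ M Y` of an invertible matrix `M` on `k[Y]`. -/
def stdAct (M : GL (Fin t) k) : PolyY t n k →ₐ[k] PolyY t n k :=
  MvPolynomial.aeval fun p =>
    ∑ l : Fin t, MvPolynomial.C ((M : Matrix (Fin t) (Fin t) k) p.1 l) *
      MvPolynomial.X (l, p.2)

/-- The ring `k[Y][U]`, where `U` is a `t × t` matrix of new indeterminates. -/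
abbrev PolyYU := MvPolynomial (Fin t × Fin t) (PolyY t n k)

/-- The `k`-algebra map `φ : k[Y] → k[Y][U]`, `Y ↦ U Y`. -/
def stdPhi : PolyY t n k →ₐ[k] PolyYU t n k :=
  MvPolynomial.aeval fun p =>
    ∑ l : Fin t, MvPolynomial.X (p.1, l) *
      MvPolynomial.C (MvPolynomial.X (l, p.2) : PolyY t n k)

end Standard

/-! ### Copies of the standard and the dual representations -/

section Dual

variable (t m n : ℕ) (k : Type*) [Field k]

/-- The polynomial ring `k[X, Y]` for an `m × t` matrix `X` (the variables `Sum.inl (i, j)`) and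
a `t × n` matrix `Y` (the variables `Sum.inr (i, j)`) of indeterminates. -/
abbrev PolyXY := MvPolynomial ((Fin m × Fin t) ⊕ (Fin t × Fin n)) k

variable {k} in
/-- The action `X ↦ X M⁻¹`, `Y ↦ M Y` of an invertible matrix `M` on `k[X, Y]`. -/
def dualAct (M : GL (Fin t) k) : PolyXY t m n k →ₐ[k] PolyXY t m n k :=
  MvPolynomial.aeval (Sum.elim
    (fun p => ∑ l : Fin t, MvPolynomial.X (Sum.inl (p.1, l)) *
      MvPolynomial.C (((M⁻¹ : GL (Fin t) k) : Matrix (Fin t) (Fin t) k) l p.2))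
    (fun p => ∑ l : Fin t, MvPolynomial.C ((M : Matrix (Fin t) (Fin t) k) p.1 l) *
      MvPolynomial.X (Sum.inr (l, p.2))))

/-- The ring `k[X, Y][U, Ū]`, where `U` (the variables `Sum.inl (i, j)`) and `Ū` (the variables
`Sum.inr (i, j)`) are `t × t` matrices of new independent indeterminates. -/
abbrev PolyXYU := MvPolynomial ((Fin t × Fin t) ⊕ (Fin t × Fin t)) (PolyXY t m n k)

/-- The `k`-algebra map `φ : k[X, Y] → k[X, Y][U, Ū]`, `X ↦ X Ūᵗ`, `Y ↦ U Y`. -/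
def dualPhi : PolyXY t m n k →ₐ[k] PolyXYU t m n k :=
  MvPolynomial.aeval (Sum.elim
    (fun p => ∑ l : Fin t, MvPolynomial.C (MvPolynomial.X (Sum.inl (p.1, l)) : PolyXY t m n k) *
      MvPolynomial.X (Sum.inr (p.2, l)))
    (fun p => ∑ l : Fin t, MvPolynomial.X (Sum.inl (p.1, l)) *
      MvPolynomial.C (MvPolynomial.X (Sum.inr (l, p.2)) : PolyXY t m n k)))

end Dual

end ReynoldsClassical

end

noncomputable section

namespace ReynoldsClassical

/-! ### Integration functionals with values in an algebra, and Reynolds operators -/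

section Coefficients

variable {k κ : Type*} [Field k] {S : Type*} [CommRing S] [Algebra k S]

/-! The field `k` need not embed in `ℂ`, and `G(k)` need not be compact, so one cannot average over
`G(k)` directly. Instead the Haar integral is turned into an algebraic object defined over `ℚ`: a
linear functional on rational polynomials in the entries of `g` and of its inverse transpose. On `C`
the latter entries are the complex conjugates of the former, so both kinds of monomial integral are
values of this functional.

The functional has three properties. It is normalised; it kills polynomials vanishing on `G`; it is
invariant under left and right translation (`isInvariantIntegral`). They suffice for the Reynolds
operator (`IsInvariantIntegral.existsUnique_reynolds`): integrating `φ(f)` amounts to averaging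
`g(f)`, the two invariances give invariant values and equivariance, and any other operator `R'`
satisfies `R' f = ∫ R' (g f) = R' (∫ g f) = ∫ g f`.

Moving between `ℚ`, `k` and `C` rests on two Zariski density statements. `G(ℚ)` is dense in `G(K)`
for every `K` of characteristic zero (`rationalPointsDense`): open pieces of the groups have
rational parametrisations, by matrix entries for `GL`, by rescaling a row for `SL`, and by Cayley
transforms translated by rational isometries for `O` and `Sp`. `C` is dense in `G(ℂ)`
(`compactForm_dense`): write `M = U P^(1/2)` and continue analytically from the unitary matrices `U
P^(is)`.

Rationality (`dual_compactIntegral_eq`) is an instance of uniqueness of invariant integrals.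
Composing the complex integral with a `ℚ`-linear `e : ℂ → ℚ` fixing `1` again gives a normalised
invariant functional; comparing it with the integral by a Fubini argument, carried out algebraically
through the comultiplication, shows that the two agree. -/

theorem eq_of_forall_dual {x y : S} (h : ∀ e : S →ₗ[k] k, e x = e y) : x = y := by
  rw [← sub_eq_zero, ← Module.forall_dual_apply_eq_zero_iff k]
  intro e
  rw [map_sub, h e, sub_self]

/-- Apply an additive map to all coefficients of a polynomial. -/
def mapCoeff {A B : Type*} [CommRing A] [CommRing B] (e : A →+ B) :
    MvPolynomial κ A →+ MvPolynomial κ B where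
  toFun p := ∑ I ∈ p.support, MvPolynomial.monomial I (e (p.coeff I))
  map_zero' := by simp
  map_add' p q := by
    classical
    ext J
    have key : ∀ p : MvPolynomial κ A,
        (∑ I ∈ p.support, MvPolynomial.monomial I (e (p.coeff I))).coeff J = e (p.coeff J) := by
      intro p
      rw [MvPolynomial.coeff_sum]
      simp only [MvPolynomial.coeff_monomial]
      rw [Finset.sum_ite_eq']
      split_ifs with h
      · rfl
      · rw [MvPolynomial.notMem_support_iff.mp h, map_zero]
    rw [MvPolynomial.coeff_add, key, key, key, MvPolynomial.coeff_add, map_add]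

theorem mapCoeff_monomial {A B : Type*} [CommRing A] [CommRing B] (e : A →+ B) (I : κ →₀ ℕ)
    (a : A) : mapCoeff e (MvPolynomial.monomial I a) = MvPolynomial.monomial I (e a) := by
  classical
  simp only [mapCoeff, AddMonoidHom.coe_mk, ZeroHom.coe_mk]
  by_cases ha : a = 0
  · simp [ha]
  · rw [MvPolynomial.support_monomial, if_neg ha]
    simp

theorem map_mul_algebraMap {T : Type*} [CommRing T] [Algebra k T] (e : S →ₗ[k] T) (a : S) (r : k) :
    e (a * algebraMap k S r) = e a * algebraMap k T r := by
  rw [mul_comm, ← Algebra.smul_def, map_smul, Algebra.smul_def, mul_comm]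

/-- The evaluation point has scalar coordinates, so evaluation only forms `k`-linear combinations of
the coefficients, and `e` need not be multiplicative. -/
theorem map_eval_algebraMap {T : Type*} [CommRing T] [Algebra k T] (e : S →ₗ[k] T)
    (p : MvPolynomial κ S) (x : κ → k) :
    e (MvPolynomial.eval (fun i => algebraMap k S (x i)) p) =
      MvPolynomial.eval (fun i => algebraMap k T (x i)) (mapCoeff e.toAddMonoidHom p) := by
  induction p using MvPolynomial.induction_on' with
  | monomial I a =>
    rw [mapCoeff_monomial, MvPolynomial.eval_monomial, MvPolynomial.eval_monomial]
    have h : ∀ (A : Type _) [CommRing A] [Algebra k A],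
        (I.prod fun n e => (algebraMap k A (x n)) ^ e) =
          algebraMap k A (I.prod fun n e => x n ^ e) := by
      intro A _ _
      simp [Finsupp.prod, map_prod]
    have h' : (I.prod fun n e => (algebraMap k T (x n)) ^ e) =
          algebraMap k T (I.prod fun n e => x n ^ e) := by
      simp [Finsupp.prod, map_prod]
    rw [h, h', map_mul_algebraMap]
    rfl
  | add p q hp hq => rw [map_add, map_add, map_add, map_add, hp, hq]

end Coefficients

section Integration

variable {k κ : Type*} [Field k] [CharZero k]

/-- The `S`-linear functional on `S[U]` sending a monomial `u^I` to the rational number `c I`. -/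
def integrate (c : (κ →₀ ℕ) → ℚ) (k S : Type*) [Field k] [CharZero k] [CommRing S] [Algebra k S] :
    MvPolynomial κ S →ₗ[S] S :=
  (MvPolynomial.basisMonomials κ S).constr S fun I => algebraMap k S ((c I : ℚ) : k)

variable (c : (κ →₀ ℕ) → ℚ) {S : Type*} [CommRing S] [Algebra k S]

theorem integrate_apply (p : MvPolynomial κ S) :
    integrate c k S p = ∑ I ∈ p.support, p.coeff I * algebraMap k S ((c I : ℚ) : k) := by
  rw [integrate, Module.Basis.constr_apply]
  rfl

theorem integrate_monomial (I : κ →₀ ℕ) (a : S) :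
    integrate c k S (MvPolynomial.monomial I a) = a * algebraMap k S ((c I : ℚ) : k) := by
  have h : MvPolynomial.monomial I a = a • MvPolynomial.basisMonomials κ S I := by
    rw [MvPolynomial.coe_basisMonomials, MvPolynomial.smul_monomial, smul_eq_mul, mul_one]
  rw [h, map_smul, integrate, Module.Basis.constr_basis, smul_eq_mul]

theorem integrate_C (h0 : c 0 = 1) (a : S) : integrate c k S (MvPolynomial.C a) = a := by
  rw [← MvPolynomial.monomial_zero', integrate_monomial, h0]
  simp

/-- The integral is a finite combination of coefficients with scalar weights. This is what lets
group actions and Reynolds operators pass under the integral sign. -/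
theorem map_integrate {T : Type*} [CommRing T] [Algebra k T] (e : S →ₗ[k] T)
    (p : MvPolynomial κ S) :
    e (integrate c k S p) = integrate c k T (mapCoeff e.toAddMonoidHom p) := by
  induction p using MvPolynomial.induction_on' with
  | monomial I a =>
    rw [mapCoeff_monomial, integrate_monomial, integrate_monomial, map_mul_algebraMap]
    rfl
  | add p q hp hq => rw [map_add, map_add, map_add, map_add, hp, hq]

end Integration

section Reynolds

variable {k κ G : Type*} [Field k] [CharZero k]

/-- The functional on `k[U]` attached to `c` factors through the functions on the points `v g`
and is invariant under translations on both sides. -/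
structure IsInvariantIntegral [Mul G] (v : G → κ → k) (c : (κ →₀ ℕ) → ℚ) : Prop where
  map_one : c 0 = 1
  vanish : ∀ p : MvPolynomial κ k, (∀ g, MvPolynomial.eval (v g) p = 0) → integrate c k k p = 0
  left : ∀ (g : G) (p q : MvPolynomial κ k),
    (∀ h, MvPolynomial.eval (v h) q = MvPolynomial.eval (v (g * h)) p) →
      integrate c k k q = integrate c k k p
  right : ∀ (g : G) (p q : MvPolynomial κ k),
    (∀ h, MvPolynomial.eval (v h) q = MvPolynomial.eval (v (h * g)) p) →
      integrate c k k q = integrate c k k p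

variable {S : Type*} [CommRing S] [Algebra k S]

variable [Mul G] {v : G → κ → k} {c : (κ →₀ ℕ) → ℚ}

/-- Functionals `S → k` separate the points of `S`; applying one to all coefficients reduces the
claim to coefficients in `k`, where `vanish` applies. The two translation lemmas below follow the
same pattern. -/
theorem IsInvariantIntegral.integrate_eq_of_eval_eq (hc : IsInvariantIntegral v c)
    (p q : MvPolynomial κ S) (h : ∀ g, MvPolynomial.eval (fun i => algebraMap k S (v g i)) p =
      MvPolynomial.eval (fun i => algebraMap k S (v g i)) q) :
    integrate c k S p = integrate c k S q := by
  refine eq_of_forall_dual (k := k) fun e => ?_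
  rw [map_integrate, map_integrate, ← sub_eq_zero, ← map_sub]
  refine hc.vanish _ fun g => ?_
  have := congrArg e (h g)
  rw [map_eval_algebraMap, map_eval_algebraMap] at this
  simpa [sub_eq_zero] using this

theorem IsInvariantIntegral.integrate_left (hc : IsInvariantIntegral v c) (g : G)
    (p q : MvPolynomial κ S) (h : ∀ h, MvPolynomial.eval (fun i => algebraMap k S (v h i)) q =
      MvPolynomial.eval (fun i => algebraMap k S (v (g * h) i)) p) :
    integrate c k S q = integrate c k S p := by
  refine eq_of_forall_dual (k := k) fun e => ?_
  rw [map_integrate, map_integrate]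
  refine hc.left g _ _ fun x => ?_
  have := congrArg e (h x)
  rwa [map_eval_algebraMap, map_eval_algebraMap] at this

theorem IsInvariantIntegral.integrate_right (hc : IsInvariantIntegral v c) (g : G)
    (p q : MvPolynomial κ S) (h : ∀ h, MvPolynomial.eval (fun i => algebraMap k S (v h i)) q =
      MvPolynomial.eval (fun i => algebraMap k S (v (h * g) i)) p) :
    integrate c k S q = integrate c k S p := by
  refine eq_of_forall_dual (k := k) fun e => ?_
  rw [map_integrate, map_integrate]
  refine hc.right g _ _ fun x => ?_
  have := congrArg e (h x)
  rwa [map_eval_algebraMap, map_eval_algebraMap] at this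

/-- Integrating the generic translate of `f` is the unique Reynolds operator. -/
theorem IsInvariantIntegral.existsUnique_reynolds (hc : IsInvariantIntegral v c)
    (act : G → S →ₐ[k] S) (φ : S →ₐ[k] MvPolynomial κ S)
    (hact : ∀ g f, act g f = MvPolynomial.eval (fun i => algebraMap k S (v g i)) (φ f))
    (hmul : ∀ g h f, act h (act g f) = act (g * h) f) :
    ∃ R : S →ₗ[k] invariants act, IsReynoldsOperator _ R ∧
      (∀ R', IsReynoldsOperator _ R' → R' = R) ∧ ∀ f, (R f : S) = integrate c k S (φ f) := by
  have hinv : ∀ f, integrate c k S (φ f) ∈ invariants act := by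
    intro f
    rw [mem_invariants]
    intro g
    have h1 := map_integrate c (act g).toLinearMap (φ f)
    rw [AlgHom.toLinearMap_apply] at h1
    rw [h1]
    -- Acting by `g` on the coefficients of `φ f` turns the value at `h` into the value at `h * g`.
    refine hc.integrate_right g _ _ fun h => ?_
    rw [← map_eval_algebraMap, ← hact, ← hact, AlgHom.toLinearMap_apply, hmul]
  let R : S →ₗ[k] invariants act :=
    LinearMap.codRestrict (Subalgebra.toSubmodule (invariants act))
      ((integrate c k S).restrictScalars k ∘ₗ φ.toLinearMap) hinv
  have hR : ∀ f, (R f : S) = integrate c k S (φ f) := fun f => rfl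
  have hfix : ∀ r : invariants act, R (r : S) = r := by
    intro r
    apply Subtype.ext
    -- For invariant `r`, the polynomial `φ r` takes the same value at every group element as the
    -- constant `r`.
    rw [hR, ← integrate_C (k := k) c hc.map_one (r : S)]
    refine hc.integrate_eq_of_eval_eq _ _ fun g => ?_
    rw [← hact, integrate_C c hc.map_one, MvPolynomial.eval_C]
    exact (mem_invariants act _).mp r.2 g
  refine ⟨R, ⟨hfix, fun g s => ?_⟩, fun R' hR' => ?_, hR⟩
  · apply Subtype.ext
    rw [hR, hR]
    refine hc.integrate_left g _ _ fun h => ?_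
    rw [← hact, ← hact, hmul]
  · ext f
    -- Uniqueness: evaluate `R'` on the integral of `φ f` in two ways. That integral is the
    -- invariant `R f`, which `R'` fixes; moving `R'` inside leaves the integral of the constant `R'
    -- f`, by equivariance.
    have h1 := map_integrate c ((invariants act).val.toLinearMap ∘ₗ R') (φ f)
    have h2 : ((invariants act).val.toLinearMap ∘ₗ R') (integrate c k S (φ f)) = R f := by
      rw [← hR]
      exact congrArg Subtype.val (hR'.splitting (R f))
    have h3 : (R' f : S) = integrate c k S (MvPolynomial.C (R' f : S)) := by
      rw [integrate_C c hc.map_one]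
    rw [← h2, h1, h3]
    refine hc.integrate_eq_of_eval_eq _ _ fun g => ?_
    rw [← map_eval_algebraMap, ← hact, MvPolynomial.eval_C]
    exact congrArg Subtype.val (hR'.equivariant g f).symm

/-- Forgetting some coordinates preserves invariance. With `e = Sum.inl` this deduces the statement
about `Y` alone from the one involving `U` and its conjugate. -/
theorem IsInvariantIntegral.comap {κ' : Type*} (hc : IsInvariantIntegral v c) (e : κ' → κ) :
    IsInvariantIntegral (fun g i => v g (e i)) fun I => c (I.mapDomain e) := by
  have key : ∀ p : MvPolynomial κ' k, integrate (fun I => c (I.mapDomain e)) k k p =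
      integrate c k k (MvPolynomial.rename e p) := by
    intro p
    induction p using MvPolynomial.induction_on' with
    | monomial I a => rw [MvPolynomial.rename_monomial, integrate_monomial, integrate_monomial]
    | add p q hp hq => rw [map_add, map_add, map_add, hp, hq]
  have hev : ∀ (g : G) (p : MvPolynomial κ' k), MvPolynomial.eval (fun i => v g (e i)) p =
      MvPolynomial.eval (v g) (MvPolynomial.rename e p) := by
    intro g p
    rw [MvPolynomial.eval_rename]
    rfl
  refine ⟨by simpa using hc.map_one, fun p h => ?_, fun g p q h => ?_, fun g p q h => ?_⟩
  · rw [key]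
    exact hc.vanish _ fun g => by rw [← hev, h]
  · rw [key, key]
    exact hc.left g _ _ fun x => by rw [← hev, ← hev, h]
  · rw [key, key]
    exact hc.right g _ _ fun x => by rw [← hev, ← hev, h]

end Reynolds

/-! ### Functions with denominators a power of a fixed polynomial -/

section RegularAway

variable {K τ : Type*} [Field K]

/-- On the set where `d` does not vanish, `φ` is the quotient of a polynomial by a power of `d`. -/
def IsRegularAway (d : MvPolynomial τ K) (φ : (τ → K) → K) : Prop :=
  ∃ (n : ℕ) (F : MvPolynomial τ K), ∀ x, MvPolynomial.eval x d ≠ 0 →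
    MvPolynomial.eval x F = MvPolynomial.eval x d ^ n * φ x

variable {d : MvPolynomial τ K} {φ ψ : (τ → K) → K}

theorem isRegularAway_eval (p : MvPolynomial τ K) :
    IsRegularAway d fun x => MvPolynomial.eval x p :=
  ⟨0, p, fun x _ => by simp⟩

theorem isRegularAway_const (a : K) : IsRegularAway d fun _ => a :=
  ⟨0, MvPolynomial.C a, fun x _ => by simp⟩

theorem isRegularAway_inv : IsRegularAway d fun x => (MvPolynomial.eval x d)⁻¹ :=
  ⟨1, 1, fun x hx => by simp [hx]⟩

theorem IsRegularAway.mul (hφ : IsRegularAway d φ) (hψ : IsRegularAway d ψ) :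
    IsRegularAway d fun x => φ x * ψ x := by
  obtain ⟨n, F, hF⟩ := hφ
  obtain ⟨m, H, hH⟩ := hψ
  refine ⟨n + m, F * H, fun x hx => ?_⟩
  rw [map_mul, hF x hx, hH x hx]
  ring

theorem IsRegularAway.add (hφ : IsRegularAway d φ) (hψ : IsRegularAway d ψ) :
    IsRegularAway d fun x => φ x + ψ x := by
  obtain ⟨n, F, hF⟩ := hφ
  obtain ⟨m, H, hH⟩ := hψ
  refine ⟨n + m, d ^ m * F + d ^ n * H, fun x hx => ?_⟩
  rw [map_add, map_mul, map_mul, hF x hx, hH x hx, map_pow, map_pow]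
  ring

theorem IsRegularAway.congr (hφ : IsRegularAway d φ)
    (h : ∀ x, MvPolynomial.eval x d ≠ 0 → ψ x = φ x) : IsRegularAway d ψ := by
  obtain ⟨n, F, hF⟩ := hφ
  exact ⟨n, F, fun x hx => by rw [hF x hx, h x hx]⟩

theorem IsRegularAway.eval_comp {ι : Type*} {f : (τ → K) → ι → K}
    (hf : ∀ i, IsRegularAway d fun x => f x i) (p : MvPolynomial ι K) :
    IsRegularAway d fun x => MvPolynomial.eval (f x) p := by
  induction p using MvPolynomial.induction_on with
  | C a => simpa using isRegularAway_const a
  | add p q hp hq => simpa using hp.add hq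
  | mul_X p i hp => simpa using hp.mul (hf i)

/-- A regular function vanishing at the rational points vanishes. -/
theorem IsRegularAway.eq_zero [CharZero K] (hφ : IsRegularAway d φ)
    (h : ∀ x : τ → ℚ, MvPolynomial.eval (fun i => (x i : K)) d ≠ 0 → φ (fun i => (x i : K)) = 0)
    (x : τ → K) (hx : MvPolynomial.eval x d ≠ 0) : φ x = 0 := by
  obtain ⟨n, F, hF⟩ := hφ
  -- The factor `d` makes the product vanish at every rational point, including those where `φ` is
  -- not controlled; a polynomial vanishing on a product of infinite sets is zero.
  have hzero : F * d = 0 := by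
    refine MvPolynomial.funext_set (fun _ => Set.range ((↑) : ℚ → K))
      (fun _ => Set.infinite_range_of_injective Rat.cast_injective) fun y hy => ?_
    choose z hz using fun i => hy i (Set.mem_univ i)
    obtain rfl : (fun i => (z i : K)) = y := funext hz
    by_cases h0 : MvPolynomial.eval (fun i => (z i : K)) d = 0
    · simp [h0]
    · rw [map_mul, hF _ h0, h z h0]
      simp
  have h1 := congrArg (MvPolynomial.eval x) hzero
  rw [map_mul, hF x hx, map_zero] at h1
  simpa [hx] using h1

end RegularAway

/-! ### Polynomial functions of a matrix and its inverse -/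

section Coordinates

/-- The entries of `g`, followed by the entries of its inverse transpose. -/
abbrev Idx (t : ℕ) := (Fin t × Fin t) ⊕ (Fin t × Fin t)

variable {t : ℕ} {K : Type*} [Field K]

/-- The coordinates of an invertible matrix: its entries and those of its inverse transpose. -/
def coord (g : GL (Fin t) K) : Idx t → K :=
  Sum.elim (fun p => (g : Matrix (Fin t) (Fin t) K) p.1 p.2)
    (fun p => ((g⁻¹ : GL (Fin t) K) : Matrix (Fin t) (Fin t) K) p.2 p.1)

/-- The base change of an invertible rational matrix. -/
def ofRat (K : Type*) [Field K] [CharZero K] : GL (Fin t) ℚ →* GL (Fin t) K :=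
  Matrix.GeneralLinearGroup.map (algebraMap ℚ K)

theorem coord_ofRat [CharZero K] (g : GL (Fin t) ℚ) (i : Idx t) :
    coord (ofRat K g) i = ((coord g i : ℚ) : K) := by
  rcases i with i | i
  · simp [coord, ofRat]
  · simp only [coord, Sum.elim_inr, ← map_inv]
    rfl

theorem eval_coord_ofRat [CharZero K] (g : GL (Fin t) ℚ) (p : MvPolynomial (Idx t) ℚ) :
    MvPolynomial.eval (coord (ofRat K g)) (MvPolynomial.map (algebraMap ℚ K) p) =
      ((MvPolynomial.eval (coord g) p : ℚ) : K) := by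
  induction p using MvPolynomial.induction_on with
  | C a => simp
  | add p q hp hq => simp [hp, hq]
  | mul_X p i hp => simp [hp, coord_ofRat]

end Coordinates

/-- The rational points of `G` are Zariski dense in the `K`-points. -/
def RationalPointsDense (F : Family) (t : ℕ) (K : Type*) [Field K] [CharZero K] : Prop :=
  ∀ p : MvPolynomial (Idx t) K,
    (∀ g ∈ classicalGroup F t ℚ, MvPolynomial.eval (coord (ofRat K g)) p = 0) →
      ∀ g ∈ classicalGroup F t K, MvPolynomial.eval (coord g) p = 0

/-! ### Density of rational points in `GL` and `SL` -/

section General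

variable {t : ℕ} {K : Type*} [Field K] [CharZero K]

theorem rationalPointsDense_general : RationalPointsDense .general t K := by
  intro p hp g _
  let Z : Matrix (Fin t) (Fin t) (MvPolynomial (Fin t × Fin t) K) :=
    Matrix.of fun i j => MvPolynomial.X (i, j)
  have hZ : ∀ x : Fin t × Fin t → K, (MvPolynomial.eval x).mapMatrix Z =
      Matrix.of fun i j => x (i, j) := by
    intro x
    ext i j
    simp [Z]
  -- By Cramer's rule the coordinates of an invertible matrix are regular functions of its entries
  -- away from `det = 0`.
  let f : (Fin t × Fin t → K) → Idx t → K := fun x =>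
    Sum.elim (fun p => x p)
      (fun p => (MvPolynomial.eval x Z.det)⁻¹ * MvPolynomial.eval x (Z.adjugate p.2 p.1))
  have hf : ∀ i, IsRegularAway Z.det fun x => f x i := by
    rintro (i | i)
    · exact (isRegularAway_eval (MvPolynomial.X i)).congr fun x _ => by simp [f]
    · exact isRegularAway_inv.mul (isRegularAway_eval (Z.adjugate i.2 i.1))
  have hcoord : ∀ g : GL (Fin t) K, ∀ x, (∀ i j, x (i, j) = (g : Matrix (Fin t) (Fin t) K) i j) →
      f x = coord g ∧ MvPolynomial.eval x Z.det ≠ 0 := by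
    intro g x hx
    have hg : (MvPolynomial.eval x).mapMatrix Z = (g : Matrix (Fin t) (Fin t) K) := by
      rw [hZ]
      ext i j
      exact hx i j
    have hdet : MvPolynomial.eval x Z.det = (g : Matrix (Fin t) (Fin t) K).det := by
      rw [RingHom.map_det, hg]
    refine ⟨?_, ?_⟩
    · ext i
      rcases i with i | i
      · exact hx i.1 i.2
      · have : MvPolynomial.eval x (Z.adjugate i.2 i.1) =
            (g : Matrix (Fin t) (Fin t) K).adjugate i.2 i.1 := by
          rw [← hg, ← RingHom.map_adjugate]
          rfl
        simp only [f, coord, Sum.elim_inr]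
        rw [this, hdet, Matrix.coe_units_inv, Matrix.inv_def, Ring.inverse_eq_inv']
        rfl
    · rw [hdet]
      exact (Matrix.isUnit_iff_isUnit_det _).mp g.isUnit |>.ne_zero
  obtain ⟨h1, h2⟩ := hcoord g (fun p => (g : Matrix (Fin t) (Fin t) K) p.1 p.2) fun _ _ => rfl
  rw [← h1]
  refine (IsRegularAway.eval_comp hf p).eq_zero (fun x hx => ?_) _ h2
  have hdet : (Matrix.of fun i j => x (i, j) : Matrix (Fin t) (Fin t) ℚ).det ≠ 0 := by
    intro h0
    apply hx
    rw [RingHom.map_det, hZ]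
    have : (Matrix.of fun i j => (x (i, j) : K) : Matrix (Fin t) (Fin t) K) =
        (algebraMap ℚ K).mapMatrix (Matrix.of fun i j => x (i, j)) := by
      ext i j
      simp
    rw [this, ← RingHom.map_det, h0, map_zero]
  let y : GL (Fin t) ℚ := Matrix.GeneralLinearGroup.mkOfDetNeZero _ hdet
  have := (hcoord (ofRat K y) (fun i => (x i : K)) fun i j => by
    simp [ofRat, y, Matrix.GeneralLinearGroup.mkOfDetNeZero]).1
  rw [this]
  exact hp y (Subgroup.mem_top _)

/-- The polynomials giving the coordinates of `diag(det g⁻¹, 1, …, 1) g`. -/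
def normalizeDet (K : Type*) [Field K] (i₀ : Fin t) : Idx t → MvPolynomial (Idx t) K :=
  Sum.elim
    (fun p => (if p.1 = i₀ then
      (Matrix.of fun i j => (MvPolynomial.X (Sum.inr (j, i)) : MvPolynomial (Idx t) K)).det else 1)
        * MvPolynomial.X (Sum.inl p))
    (fun p => (if p.1 = i₀ then
      (Matrix.of fun i j => (MvPolynomial.X (Sum.inl (i, j)) : MvPolynomial (Idx t) K)).det else 1)
        * MvPolynomial.X (Sum.inr p))

/-- Dividing the row `i₀` by the determinant retracts `GL` onto `SL`. The map is polynomial because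
`det g⁻¹` is a polynomial in the inverse coordinates; the inverse transpose has its row `i₀`
multiplied by `det g`. -/
theorem eval_normalizeDet (K : Type*) [Field K] (i₀ : Fin t) (g : GL (Fin t) K) :
    ∃ h ∈ classicalGroup .special t K, (g ∈ classicalGroup .special t K → h = g) ∧
      (fun i => MvPolynomial.eval (coord g) (normalizeDet K i₀ i)) = coord h := by
  have hd : (g : Matrix (Fin t) (Fin t) K).det ≠ 0 :=
    (Matrix.isUnit_iff_isUnit_det _).mp g.isUnit |>.ne_zero
  let u : Kˣ := Matrix.GeneralLinearGroup.det g
  have hu : (u : K) = (g : Matrix (Fin t) (Fin t) K).det := rfl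
  have hu' : ((u⁻¹ : Kˣ) : K) = ((g⁻¹ : GL (Fin t) K) : Matrix (Fin t) (Fin t) K).det := by
    rw [← map_inv]
    rfl
  let D : GL (Fin t) K :=
    ⟨Matrix.diagonal (Function.update 1 i₀ ((u⁻¹ : Kˣ) : K)),
      Matrix.diagonal (Function.update 1 i₀ (u : K)), by
        rw [Matrix.diagonal_mul_diagonal, ← Matrix.diagonal_one]
        congr 1
        ext i
        by_cases h : i = i₀
        · subst h; simp
        · simp [h], by
        rw [Matrix.diagonal_mul_diagonal, ← Matrix.diagonal_one]
        congr 1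
        ext i
        by_cases h : i = i₀
        · subst h; simp
        · simp [h]⟩
  have hD : (D : Matrix (Fin t) (Fin t) K) =
    Matrix.diagonal (Function.update 1 i₀ ((u⁻¹ : Kˣ) : K)) := rfl
  have hDi : ((D⁻¹ : GL (Fin t) K) : Matrix (Fin t) (Fin t) K) =
    Matrix.diagonal (Function.update 1 i₀ (u : K)) := rfl
  have hdetD : Matrix.GeneralLinearGroup.det D = u⁻¹ := by
    ext
    change (D : Matrix (Fin t) (Fin t) K).det = _
    rw [hD, Matrix.det_diagonal, Finset.prod_update_of_mem (Finset.mem_univ _)]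
    simp
  refine ⟨D * g, ?_, ?_, ?_⟩
  · change _ ∈ MonoidHom.ker _
    rw [MonoidHom.mem_ker, map_mul, hdetD]
    exact inv_mul_cancel u
  · intro hg
    have h1 : u = 1 := hg
    have : D = 1 := by
      ext i j
      rw [hD, h1]
      simp
    rw [this, one_mul]
  · ext i
    have e1 : MvPolynomial.eval (coord g) (Matrix.of fun i j =>
        (MvPolynomial.X (Sum.inr (j, i)) : MvPolynomial (Idx t) K)).det = ((u⁻¹ : Kˣ) : K) := by
      rw [hu', RingHom.map_det]
      congr 1
      ext i j
      simp [coord]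
    have e2 : MvPolynomial.eval (coord g) (Matrix.of fun i j =>
        (MvPolynomial.X (Sum.inl (i, j)) : MvPolynomial (Idx t) K)).det = (u : K) := by
      rw [hu, RingHom.map_det]
      congr 1
      ext i j
      simp [coord]
    rcases i with i | i
    · have : coord (D * g) (Sum.inl i) = ((D : Matrix (Fin t) (Fin t) K) * g) i.1 i.2 := rfl
      rw [this, hD, Matrix.diagonal_mul]
      simp only [normalizeDet, Sum.elim_inl, map_mul, MvPolynomial.eval_X, apply_ite, map_one, e1]
      by_cases h : i.1 = i₀
      · rw [if_pos h, h, Function.update_self]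
        simp [coord, ← h]
      · simp [h, coord]
    · have : coord (D * g) (Sum.inr i) =
          (((g⁻¹ : GL (Fin t) K) : Matrix (Fin t) (Fin t) K) *
            ((D⁻¹ : GL (Fin t) K) : Matrix (Fin t) (Fin t) K)) i.2 i.1 := by
        simp only [coord, Sum.elim_inr, mul_inv_rev]
        rfl
      rw [this, hDi, Matrix.mul_diagonal]
      simp only [normalizeDet, Sum.elim_inr, map_mul, MvPolynomial.eval_X, apply_ite, map_one, e2]
      by_cases h : i.1 = i₀
      · rw [if_pos h, h, Function.update_self, mul_comm]
        simp [coord, ← h]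
      · simp [h, coord]

theorem map_normalizeDet (i₀ : Fin t) (i : Idx t) :
    MvPolynomial.map (algebraMap ℚ K) (normalizeDet ℚ i₀ i) = normalizeDet K i₀ i := by
  have h : ∀ f : Fin t → Fin t → Idx t,
      MvPolynomial.map (algebraMap ℚ K) (Matrix.of fun i j =>
        (MvPolynomial.X (f i j) : MvPolynomial (Idx t) ℚ)).det =
          (Matrix.of fun i j => (MvPolynomial.X (f i j) : MvPolynomial (Idx t) K)).det := by
    intro f
    rw [RingHom.map_det]
    congr 1
    ext1 i j
    simp
  rcases i with i | i
  · simp only [normalizeDet, Sum.elim_inl, map_mul, MvPolynomial.map_X, apply_ite, map_one, h]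
  · simp only [normalizeDet, Sum.elim_inr, map_mul, MvPolynomial.map_X, apply_ite, map_one, h]

theorem rationalPointsDense_special (ht : 0 < t) : RationalPointsDense .special t K := by
  intro p hp g hg
  have hsub : ∀ g : GL (Fin t) K, MvPolynomial.eval (coord g)
      (MvPolynomial.bind₁ (normalizeDet K ⟨0, ht⟩) p) =
        MvPolynomial.eval (fun i => MvPolynomial.eval (coord g) (normalizeDet K ⟨0, ht⟩ i)) p :=
    fun g => MvPolynomial.aeval_bind₁ (coord g) (normalizeDet K ⟨0, ht⟩) p
  -- Pulling `p` back along the retraction gives a polynomial vanishing on `GL(ℚ)`, since the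
  -- retraction is defined over `ℚ`.
  have hgen := rationalPointsDense_general (MvPolynomial.bind₁ (normalizeDet K ⟨0, ht⟩) p)
    (fun y _ => ?_) g (Subgroup.mem_top g)
  · obtain ⟨h, -, h1, h2⟩ := eval_normalizeDet K ⟨0, ht⟩ g
    rwa [hsub, h2, h1 hg] at hgen
  · obtain ⟨h, h0, -, h2⟩ := eval_normalizeDet ℚ ⟨0, ht⟩ y
    rw [hsub, ← hp h h0]
    congr 2
    ext i
    rw [← map_normalizeDet, eval_coord_ofRat, coord_ofRat, ← h2]

end General

/-! ### Isometry groups: reflections, transvections and the Cayley transform -/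

section Isometry

variable {t : ℕ} {K : Type*} [Field K]

/-- The properties shared by the symmetric form `I` and the alternating form `Ω`. -/
structure IsClassicalForm (B : Matrix (Fin t) (Fin t) K) (ε c : K) : Prop where
  transpose_eq : B.transpose = ε • B
  sign_sq : ε * ε = 1
  transpose_mul_self : B.transpose * B = 1
  reflection : ∀ i, c * (1 + ε) + c ^ 2 * ε * B i i = 0
  ne_zero : c ≠ 0

theorem mem_isometryGroup {B : Matrix (Fin t) (Fin t) K} {M : GL (Fin t) K} :
    M ∈ isometryGroup B ↔ (M : Matrix (Fin t) (Fin t) K).transpose * B * M = B := Iff.rfl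

theorem IsClassicalForm.map {L : Type*} [Field L] (f : K →+* L)
    {B : Matrix (Fin t) (Fin t) K} {ε c : K} (hB : IsClassicalForm B ε c) :
    IsClassicalForm (B.map f) (f ε) (f c) where
  transpose_eq := by
    rw [← Matrix.transpose_map, hB.transpose_eq]
    ext i j
    simp
  sign_sq := by rw [← map_mul, hB.sign_sq, map_one]
  transpose_mul_self := by
    rw [← Matrix.transpose_map, ← Matrix.map_mul, hB.transpose_mul_self]
    simp
  reflection i := by
    have := congrArg f (hB.reflection i)
    simpa using this
  ne_zero := (map_ne_zero f).mpr hB.ne_zero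

variable {B : Matrix (Fin t) (Fin t) K} {ε c : K}

theorem IsClassicalForm.det_ne_zero (hB : IsClassicalForm B ε c) : B.det ≠ 0 := by
  intro h
  have := congrArg Matrix.det hB.transpose_mul_self
  rw [Matrix.det_mul, h] at this
  simp at this

theorem IsClassicalForm.det_ne_zero_of_isometry (hB : IsClassicalForm B ε c)
    {M : Matrix (Fin t) (Fin t) K} (hM : M.transpose * B * M = B) : M.det ≠ 0 := by
  intro h
  have := congrArg Matrix.det hM
  rw [Matrix.det_mul, h, mul_zero] at this
  exact hB.det_ne_zero this.symm

/-- The reflection or transvection `1 + c eᵢ eᵢᵗ B`. -/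
def elementaryIsometry (B : Matrix (Fin t) (Fin t) K) (c : K) (i : Fin t) :
    Matrix (Fin t) (Fin t) K :=
  1 + c • (Matrix.single i i 1 * B)

/-- Expanding the product leaves the multiple `c (1 + ε) + c² ε Bᵢᵢ` of `B eᵢ eᵢᵗ B` as the only
error term, and the field `reflection` says that it is zero. -/
theorem IsClassicalForm.elementaryIsometry_isometry (hB : IsClassicalForm B ε c) (i : Fin t) :
    (elementaryIsometry B c i).transpose * B * elementaryIsometry B c i = B := by
  set E : Matrix (Fin t) (Fin t) K := Matrix.single i i 1 with hE
  have h1 : E * B * E = B i i • E := by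
    rw [hE, Matrix.single_mul_mul_single]
    simp [Matrix.smul_single]
  have h2 : (elementaryIsometry B c i).transpose = 1 + (c * ε) • (B * E) := by
    rw [elementaryIsometry, Matrix.transpose_add, Matrix.transpose_smul, Matrix.transpose_mul,
      hB.transpose_eq, Matrix.transpose_one, hE, Matrix.transpose_single, Matrix.smul_mul,
      smul_smul]
  have h3 : B * E * B * (E * B) = B i i • (B * E * B) := by
    calc B * E * B * (E * B) = B * (E * B * E) * B := by simp only [Matrix.mul_assoc]
      _ = _ := by rw [h1]; simp
  have h4 := hB.reflection i
  rw [h2, elementaryIsometry, ← hE]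
  calc (1 + (c * ε) • (B * E)) * B * (1 + c • (E * B))
      = B + (c * (1 + ε) + c ^ 2 * ε * B i i) • (B * E * B) := by
        simp only [Matrix.add_mul, Matrix.mul_add, Matrix.one_mul, Matrix.mul_one,
          Matrix.smul_mul, Matrix.mul_smul, h3, ← Matrix.mul_assoc B E B]
        module
    _ = B := by rw [h4, zero_smul, add_zero]

/-- A matrix preserving the form, as an invertible matrix. -/
def isometryOfMatrix (hB : IsClassicalForm B ε c) (M : Matrix (Fin t) (Fin t) K)
    (hM : M.transpose * B * M = B) : GL (Fin t) K :=
  Matrix.GeneralLinearGroup.mkOfDetNeZero M (hB.det_ne_zero_of_isometry hM)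

theorem isometryOfMatrix_mem (hB : IsClassicalForm B ε c) (M : Matrix (Fin t) (Fin t) K)
    (hM : M.transpose * B * M = B) : isometryOfMatrix hB M hM ∈ isometryGroup B := hM

theorem ofRat_mem_isometryGroup [CharZero K] {B : Matrix (Fin t) (Fin t) ℚ} {g : GL (Fin t) ℚ}
    (hg : g ∈ isometryGroup B) : ofRat K g ∈ isometryGroup (B.map (algebraMap ℚ K)) := by
  rw [mem_isometryGroup] at hg ⊢
  have := congrArg (fun M => M.map (algebraMap ℚ K)) hg
  simpa [Matrix.map_mul, Matrix.transpose_map, ofRat] using this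

/-- Take `v ≠ 0` with `M v = -v` and `i` with `(B v)ᵢ ≠ 0`. The range of `1 + M` is orthogonal to `B
v`, so it misses `eᵢ`. The new matrix differs from `1 + M` by `w ↦ c (B w)ᵢ M eᵢ`, and `M eᵢ` is
`-eᵢ` modulo that range. Hence a vector of the new kernel has `(B w)ᵢ = 0` and lies in the old
kernel, whereas `v` is lost. -/
theorem IsClassicalForm.exists_ker_lt (hB : IsClassicalForm B ε c) {M : Matrix (Fin t) (Fin t) K}
    (hM : M.transpose * B * M = B) (h : (1 + M).det = 0) :
    ∃ i, LinearMap.ker (1 + M * elementaryIsometry B c i).mulVecLin <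
      LinearMap.ker (1 + M).mulVecLin := by
  obtain ⟨v, hv0, hv⟩ := Matrix.exists_mulVec_eq_zero_iff.mpr h
  have hBv : B.mulVec v ≠ 0 := by
    intro h0
    exact hB.det_ne_zero (Matrix.exists_mulVec_eq_zero_iff.mp ⟨v, hv0, h0⟩)
  obtain ⟨i, hi⟩ := Function.ne_iff.mp hBv
  rw [Pi.zero_apply] at hi
  have hMv : M.mulVec v = -v := by
    rw [Matrix.add_mulVec, Matrix.one_mulVec] at hv
    exact (neg_eq_of_add_eq_zero_right hv).symm
  have hrange : ∀ w, (1 + M).mulVec w ≠ Pi.single i 1 := by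
    intro w hw
    apply hi
    have h1 : (Pi.single i 1 : Fin t → K) ⬝ᵥ B.mulVec v = (B.mulVec v) i := by simp
    have h2 : M.mulVec w ⬝ᵥ B.mulVec (M.mulVec v) = w ⬝ᵥ B.mulVec v := by
      conv_rhs => rw [← hM]
      rw [← Matrix.mulVec_mulVec, ← Matrix.mulVec_mulVec, Matrix.dotProduct_mulVec w,
        Matrix.vecMul_transpose]
    rw [← h1, ← hw, Matrix.add_mulVec, Matrix.one_mulVec, add_dotProduct, ← h2, hMv,
      Matrix.mulVec_neg, dotProduct_neg, neg_add_cancel]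
  have hmul : ∀ w, (1 + M * elementaryIsometry B c i).mulVec w =
      (1 + M).mulVec w + (c * (B.mulVec w) i) • M.mulVec (Pi.single i 1) := by
    intro w
    have : (Matrix.single i i (1 : K)).mulVec (B.mulVec w) =
        (B.mulVec w) i • (Pi.single i 1 : Fin t → K) := by
      ext j
      rw [Matrix.single_mulVec]
      by_cases hj : j = i <;> simp [hj]
    rw [elementaryIsometry, Matrix.mul_add, Matrix.mul_one, ← add_assoc, Matrix.add_mulVec,
      Matrix.mul_smul, Matrix.smul_mulVec, ← Matrix.mulVec_mulVec, ← Matrix.mulVec_mulVec, this,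
      Matrix.mulVec_smul, smul_smul]
  have hsingle : M.mulVec (Pi.single i 1) = (1 + M).mulVec (Pi.single i 1) - Pi.single i 1 := by
    rw [Matrix.add_mulVec, Matrix.one_mulVec, add_sub_cancel_left]
  have hker : ∀ w, (1 + M * elementaryIsometry B c i).mulVec w = 0 → (B.mulVec w) i = 0 := by
    intro w hw
    by_contra hne
    have ha : c * (B.mulVec w) i ≠ 0 := mul_ne_zero hB.ne_zero hne
    rw [hmul, hsingle] at hw
    apply hrange (Pi.single i 1 + (c * (B.mulVec w) i)⁻¹ • w)
    rw [Matrix.mulVec_add, Matrix.mulVec_smul]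
    have := congrArg (fun u => (c * (B.mulVec w) i)⁻¹ • u) hw
    simp only [smul_add, smul_smul, inv_mul_cancel₀ ha, one_smul, smul_zero] at this
    rw [add_sub, sub_eq_zero] at this
    rw [add_comm, this]
  refine ⟨i, lt_of_le_of_ne ?_ ?_⟩
  · intro w hw
    rw [LinearMap.mem_ker, Matrix.mulVecLin_apply] at hw ⊢
    have h0 := hker w hw
    rwa [hmul, h0, mul_zero, zero_smul, add_zero] at hw
  · intro heq
    have : v ∈ LinearMap.ker (1 + M * elementaryIsometry B c i).mulVecLin := by
      rw [heq]
      exact hv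
    exact hi (hker v this)

/-- The Cayley transform only reaches matrices without eigenvalue `-1`. Multiplying by rational
reflections or transvections shrinks the kernel of `1 + M` until it is zero. -/
theorem IsClassicalForm.exists_det_ne_zero [CharZero K] {B : Matrix (Fin t) (Fin t) ℚ} {ε c : ℚ}
    (hB : IsClassicalForm B ε c) (M : GL (Fin t) K)
    (hM : M ∈ isometryGroup (B.map (algebraMap ℚ K))) :
    ∃ D ∈ isometryGroup B,
      (1 + ((M * ofRat K D : GL (Fin t) K) : Matrix (Fin t) (Fin t) K)).det ≠ 0 := by
  induction hn : Module.finrank K (LinearMap.ker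
    (1 + (M : Matrix (Fin t) (Fin t) K)).mulVecLin) using Nat.strong_induction_on generalizing M with
  | _ n ih =>
  by_cases h : (1 + (M : Matrix (Fin t) (Fin t) K)).det = 0
  · obtain ⟨i, hi⟩ := (hB.map (algebraMap ℚ K)).exists_ker_lt hM h
    let T : GL (Fin t) ℚ := isometryOfMatrix hB _ (hB.elementaryIsometry_isometry i)
    have hT : ((ofRat K T : GL (Fin t) K) : Matrix (Fin t) (Fin t) K) =
        elementaryIsometry (B.map (algebraMap ℚ K)) (algebraMap ℚ K c) i := by
      change (elementaryIsometry B c i).map (algebraMap ℚ K) = _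
      change (algebraMap ℚ K).mapMatrix (elementaryIsometry B c i) = _
      rw [elementaryIsometry, elementaryIsometry, map_add, map_one]
      congr 1
      ext a b
      simp only [RingHom.mapMatrix_apply, Matrix.map_apply, Matrix.smul_apply, Matrix.mul_apply,
        Matrix.single, ite_and]
      by_cases ha : i = a <;> simp [ha]
    rw [← hT, ← Matrix.GeneralLinearGroup.coe_mul] at hi
    have hTm : T ∈ isometryGroup B := isometryOfMatrix_mem hB _ _
    obtain ⟨D, hD, hdet⟩ := ih _ (by rw [← hn]; exact Submodule.finrank_lt_finrank_of_lt hi)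
      (M * ofRat K T) (mul_mem hM (ofRat_mem_isometryGroup hTm)) rfl
    refine ⟨T * D, mul_mem hTm hD, ?_⟩
    rwa [map_mul, ← mul_assoc]
  · exact ⟨1, one_mem _, by simpa using h⟩

end Isometry

section Cayley

variable {t : ℕ} {K : Type*} [Field K] {B : Matrix (Fin t) (Fin t) K} {ε c : K}

/-- A linear parametrisation of the Lie algebra of the isometry group. -/
def lieParam {R : Type*} [CommRing R] (B : Matrix (Fin t) (Fin t) R) (ε : R)
    (x : Matrix (Fin t) (Fin t) R) : Matrix (Fin t) (Fin t) R :=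
  B.transpose * (x - ε • x.transpose)

theorem map_lieParam {R S : Type*} [CommRing R] [CommRing S] (f : R →+* S)
    (B : Matrix (Fin t) (Fin t) R) (ε : R) (x : Matrix (Fin t) (Fin t) R) :
    f.mapMatrix (lieParam B ε x) = lieParam (B.map f) (f ε) (x.map f) := by
  rw [lieParam, map_mul, lieParam]
  congr 1
  ext i j
  simp

theorem IsClassicalForm.mul_transpose_self (hB : IsClassicalForm B ε c) :
    B * B.transpose = 1 :=
  mul_eq_one_comm.mp hB.transpose_mul_self

/-- With `Y = B A`, the Lie algebra condition on `A` reads `Y = -ε Yᵗ`, which every `x - ε xᵗ`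
satisfies; `Bᵗ` is the inverse of `B`. -/
theorem IsClassicalForm.lieParam_skew (hB : IsClassicalForm B ε c)
    (x : Matrix (Fin t) (Fin t) K) :
    (lieParam B ε x).transpose * B + B * lieParam B ε x = 0 := by
  have h1 : B * lieParam B ε x = x - ε • x.transpose := by
    rw [lieParam, ← Matrix.mul_assoc, hB.mul_transpose_self, Matrix.one_mul]
  have h2 : (lieParam B ε x).transpose * B = ε • (B * lieParam B ε x).transpose := by
    rw [Matrix.transpose_mul, hB.transpose_eq, Matrix.mul_smul, smul_smul, hB.sign_sq, one_smul]
  rw [h2, h1]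
  simp [smul_sub, smul_smul, hB.sign_sq]

theorem IsClassicalForm.exists_cayley (hB : IsClassicalForm B ε c) {A : Matrix (Fin t) (Fin t) K}
    (hA : A.transpose * B + B * A = 0) (hdet : (1 + A).det ≠ 0) :
    ∃ g ∈ isometryGroup B, (g : Matrix (Fin t) (Fin t) K) * (1 + A) = 1 - A := by
  have hu : IsUnit (1 + A).det := hdet.isUnit
  have h1 : (1 + A) * (1 + A)⁻¹ = 1 := Matrix.mul_nonsing_inv _ hu
  have h2 : (1 + A)⁻¹ * (1 + A) = 1 := Matrix.nonsing_inv_mul _ hu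
  have hA' : A.transpose * B = -(B * A) := eq_neg_of_add_eq_zero_left hA
  have e1 : (1 - A).transpose * B = B * (1 + A) := by
    rw [Matrix.transpose_sub, Matrix.transpose_one, Matrix.sub_mul, hA', Matrix.mul_add]
    simp
  have e2 : (1 + A).transpose * B = B * (1 - A) := by
    rw [Matrix.transpose_add, Matrix.transpose_one, Matrix.add_mul, hA', Matrix.mul_sub]
    simp [sub_eq_add_neg]
  have hcomm : (1 + A) * (1 - A) = (1 - A) * (1 + A) := by noncomm_ring
  have h3 : ((1 + A)⁻¹).transpose * (1 + A).transpose = 1 := by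
    rw [← Matrix.transpose_mul, h1, Matrix.transpose_one]
  have hM : ((1 - A) * (1 + A)⁻¹).transpose * B * ((1 - A) * (1 + A)⁻¹) = B := by
    calc ((1 - A) * (1 + A)⁻¹).transpose * B * ((1 - A) * (1 + A)⁻¹)
        = ((1 + A)⁻¹).transpose * ((1 - A).transpose * B) * (1 - A) * (1 + A)⁻¹ := by
          simp only [Matrix.transpose_mul, Matrix.mul_assoc]
      _ = ((1 + A)⁻¹).transpose * B * ((1 + A) * (1 - A)) * (1 + A)⁻¹ := by
          rw [e1]; simp only [Matrix.mul_assoc]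
      _ = ((1 + A)⁻¹).transpose * (B * (1 - A)) * ((1 + A) * (1 + A)⁻¹) := by
          rw [hcomm]; simp only [Matrix.mul_assoc]
      _ = ((1 + A)⁻¹).transpose * (1 + A).transpose * B := by
          rw [h1, ← e2, Matrix.mul_one, Matrix.mul_assoc]
      _ = B := by rw [h3, Matrix.one_mul]
  refine ⟨isometryOfMatrix hB _ hM, isometryOfMatrix_mem hB _ hM, ?_⟩
  change (1 - A) * (1 + A)⁻¹ * (1 + A) = 1 - A
  rw [Matrix.mul_assoc, h2, Matrix.mul_one]

theorem IsClassicalForm.exists_lieParam [CharZero K] (hB : IsClassicalForm B ε c) {g : GL (Fin t) K}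
    (hg : g ∈ isometryGroup B) (hdet : (1 + (g : Matrix (Fin t) (Fin t) K)).det ≠ 0) :
    ∃ x, (1 + lieParam B ε x).det ≠ 0 ∧
      (g : Matrix (Fin t) (Fin t) K) * (1 + lieParam B ε x) = 1 - lieParam B ε x := by
  rw [mem_isometryGroup] at hg
  set M : Matrix (Fin t) (Fin t) K := g.val with hMdef
  have hu : IsUnit (1 + M).det := hdet.isUnit
  -- The Cayley transform is its own inverse.
  set A := (1 + M)⁻¹ * (1 - M) with hAdef
  have h1 : (1 + M) * A = 1 - M := by
    rw [hAdef, ← Matrix.mul_assoc, Matrix.mul_nonsing_inv _ hu, Matrix.one_mul]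
  have h2 : A * (1 + M) = 1 - M := by
    rw [hAdef, Matrix.mul_assoc, show (1 - M) * (1 + M) = (1 + M) * (1 - M) by noncomm_ring,
      ← Matrix.mul_assoc, Matrix.nonsing_inv_mul _ hu, Matrix.one_mul]
  have hskew : A.transpose * B + B * A = 0 := by
    have key : (1 + M).transpose * (A.transpose * B + B * A) * (1 + M) = 0 := by
      calc (1 + M).transpose * (A.transpose * B + B * A) * (1 + M)
          = (A * (1 + M)).transpose * B * (1 + M) + (1 + M).transpose * B * (A * (1 + M)) := by
            rw [Matrix.transpose_mul A]
            generalize (1 + M).transpose = T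
            generalize 1 + M = N
            simp only [Matrix.mul_add, Matrix.add_mul, Matrix.mul_assoc]
        _ = (2 : K) • (B - M.transpose * B * M) := by
            rw [h2]
            simp only [Matrix.transpose_add, Matrix.transpose_sub, Matrix.transpose_one,
              Matrix.mul_add, Matrix.add_mul, Matrix.mul_sub, Matrix.sub_mul, Matrix.one_mul,
              Matrix.mul_one]
            module
        _ = 0 := by rw [hg, sub_self, smul_zero]
    have hu' : IsUnit (1 + M).transpose.det := by rwa [Matrix.det_transpose]
    calc A.transpose * B + B * A
        = ((1 + M).transpose)⁻¹ * ((1 + M).transpose * (A.transpose * B + B * A) * (1 + M)) *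
            (1 + M)⁻¹ := by
          rw [Matrix.mul_assoc (1 + M).transpose, ← Matrix.mul_assoc (1 + M).transpose⁻¹,
            Matrix.nonsing_inv_mul _ hu', Matrix.one_mul, Matrix.mul_assoc,
            Matrix.mul_nonsing_inv _ hu, Matrix.mul_one]
      _ = 0 := by rw [key]; simp
  have hx : lieParam B ε ((2⁻¹ : K) • (B * A)) = A := by
    have h3 : ε • (B * A).transpose = A.transpose * B := by
      rw [Matrix.transpose_mul, hB.transpose_eq, Matrix.mul_smul, smul_smul, hB.sign_sq, one_smul]
    have h4 : A.transpose * B = -(B * A) := eq_neg_of_add_eq_zero_left hskew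
    rw [lieParam, Matrix.transpose_smul, smul_comm ε, h3, h4, smul_neg, sub_neg_eq_add, ← add_smul,
      show (2⁻¹ : K) + 2⁻¹ = 1 by norm_num, one_smul, ← Matrix.mul_assoc, hB.transpose_mul_self,
      Matrix.one_mul]
  refine ⟨(2⁻¹ : K) • (B * A), ?_, ?_⟩
  · rw [hx]
    intro h0
    -- This identity makes `1 + A` invertible in characteristic zero.
    have h5 : (1 + M) * (1 + A) = (2 : K) • 1 := by
      rw [Matrix.mul_add, h1, two_smul, Matrix.mul_one]
      abel
    have := congrArg Matrix.det h5
    rw [Matrix.det_mul, h0, mul_zero, Matrix.det_smul, Matrix.det_one, mul_one] at this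
    exact pow_ne_zero _ two_ne_zero this.symm
  · rw [hx, Matrix.mul_add, Matrix.mul_one, eq_sub_iff_add_eq, add_assoc]
    have : M * A + A = (1 + M) * A := by rw [Matrix.add_mul, Matrix.one_mul, add_comm]
    rw [this, h1]
    abel

theorem IsClassicalForm.eval_eq_zero [CharZero K] {B : Matrix (Fin t) (Fin t) ℚ} {ε c : ℚ}
    (hB : IsClassicalForm B ε c) (p : MvPolynomial (Idx t) K)
    (hp : ∀ g ∈ isometryGroup B, MvPolynomial.eval (coord (ofRat K g)) p = 0) (g : GL (Fin t) K)
    (hg : g ∈ isometryGroup (B.map (algebraMap ℚ K))) : MvPolynomial.eval (coord g) p = 0 := by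
  obtain ⟨D, hD, hdet⟩ := hB.exists_det_ne_zero g hg
  set BK := B.map (algebraMap ℚ K) with hBKdef
  have hBK : IsClassicalForm BK (algebraMap ℚ K ε) (algebraMap ℚ K c) := hB.map (algebraMap ℚ K)
  let P := MvPolynomial (Fin t × Fin t) K
  let A : Matrix (Fin t) (Fin t) P :=
    lieParam (BK.map MvPolynomial.C) (MvPolynomial.C (algebraMap ℚ K ε))
      (Matrix.of fun i j => MvPolynomial.X (i, j))
  let a : (Fin t × Fin t → K) → Matrix (Fin t) (Fin t) K := fun x =>
    lieParam BK (algebraMap ℚ K ε) (Matrix.of fun i j => x (i, j))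
  have ha : ∀ x, (MvPolynomial.eval x).mapMatrix A = a x := by
    intro x
    rw [map_lieParam]
    simp only [a]
    congr 1
    · ext i j; simp
    · simp
    · ext i j; simp
  let E : Matrix (Fin t) (Fin t) P := (ofRat K D : Matrix (Fin t) (Fin t) K).map MvPolynomial.C
  let E' : Matrix (Fin t) (Fin t) P :=
    ((ofRat K D)⁻¹ : GL (Fin t) K).val.map MvPolynomial.C
  have hE : ∀ x, (MvPolynomial.eval x).mapMatrix E = (ofRat K D : Matrix (Fin t) (Fin t) K) := by
    intro x; ext i j; simp [E]
  have hE' : ∀ x, (MvPolynomial.eval x).mapMatrix E' = ((ofRat K D)⁻¹ : GL (Fin t) K).val := by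
    intro x; ext i j; simp [E']
  -- Both determinants are inverted because the coordinates also contain those of the inverse.
  -- Divided by `d`, `N` becomes `(1 - A)(1 + A)⁻¹ D⁻¹` and `N'` its inverse.
  let d : P := (1 + A).det * (1 - A).det
  have hd : ∀ x, MvPolynomial.eval x d = (1 + a x).det * (1 - a x).det := by
    intro x
    rw [map_mul, RingHom.map_det, RingHom.map_det, map_add, map_sub, map_one, ha]
  let N : Matrix (Fin t) (Fin t) P := (1 - A).det • ((1 - A) * (1 + A).adjugate * E')
  let N' : Matrix (Fin t) (Fin t) P := (1 + A).det • (E * ((1 + A) * (1 - A).adjugate))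
  have hN : ∀ x i j, MvPolynomial.eval x (N i j) =
      (1 - a x).det * ((1 - a x) * (1 + a x).adjugate * ((ofRat K D)⁻¹ : GL (Fin t) K).val) i j := by
    intro x i j
    change MvPolynomial.eval x ((1 - A).det * ((1 - A) * (1 + A).adjugate * E') i j) = _
    rw [map_mul, RingHom.map_det, map_sub, map_one, ha]
    congr 1
    change (MvPolynomial.eval x).mapMatrix ((1 - A) * (1 + A).adjugate * E') i j = _
    rw [map_mul, map_mul, RingHom.map_adjugate, map_sub, map_add, map_one, ha, hE']
  have hN' : ∀ x i j, MvPolynomial.eval x (N' i j) =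
      (1 + a x).det * ((ofRat K D : Matrix (Fin t) (Fin t) K) *
        ((1 + a x) * (1 - a x).adjugate)) i j := by
    intro x i j
    change MvPolynomial.eval x ((1 + A).det * (E * ((1 + A) * (1 - A).adjugate)) i j) = _
    rw [map_mul, RingHom.map_det, map_add, map_one, ha]
    congr 1
    change (MvPolynomial.eval x).mapMatrix (E * ((1 + A) * (1 - A).adjugate)) i j = _
    rw [map_mul, map_mul, RingHom.map_adjugate, map_sub, map_add, map_one, ha, hE]
  let f : (Fin t × Fin t → K) → Idx t → K := fun x =>
    Sum.elim (fun q => (MvPolynomial.eval x d)⁻¹ * MvPolynomial.eval x (N q.1 q.2))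
      (fun q => (MvPolynomial.eval x d)⁻¹ * MvPolynomial.eval x (N' q.2 q.1))
  have hf : ∀ i, IsRegularAway d fun x => f x i := by
    rintro (i | i)
    · exact isRegularAway_inv.mul (isRegularAway_eval _)
    · exact isRegularAway_inv.mul (isRegularAway_eval _)
  have hcoord : ∀ (y : GL (Fin t) K) x, (1 + a x).det ≠ 0 →
      ((y * ofRat K D : GL (Fin t) K) : Matrix (Fin t) (Fin t) K) * (1 + a x) = 1 - a x →
      f x = coord y ∧ MvPolynomial.eval x d ≠ 0 := by
    intro y x hx hy
    set y₀ : GL (Fin t) K := y * ofRat K D with hy₀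
    have hx' : (1 - a x).det ≠ 0 := by
      rw [← hy, Matrix.det_mul]
      exact mul_ne_zero ((Matrix.isUnit_iff_isUnit_det _).mp y₀.isUnit |>.ne_zero) hx
    have hdx : MvPolynomial.eval x d ≠ 0 := by
      rw [hd]
      exact mul_ne_zero hx hx'
    refine ⟨?_, hdx⟩
    have hy' : ((y₀⁻¹ : GL (Fin t) K) : Matrix (Fin t) (Fin t) K) * (1 - a x) = 1 + a x := by
      rw [← hy, ← Matrix.mul_assoc, ← Matrix.GeneralLinearGroup.coe_mul, inv_mul_cancel]
      simp
    have e1 : (1 - a x) * (1 + a x).adjugate = (1 + a x).det • (y₀ : Matrix (Fin t) (Fin t) K) := by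
      rw [← hy, Matrix.mul_assoc, Matrix.mul_adjugate]
      simp
    have e2 : (1 + a x) * (1 - a x).adjugate =
        (1 - a x).det • ((y₀⁻¹ : GL (Fin t) K) : Matrix (Fin t) (Fin t) K) := by
      conv_lhs => rw [← hy', Matrix.mul_assoc, Matrix.mul_adjugate]
      simp
    have e3 : (y₀ : Matrix (Fin t) (Fin t) K) * ((ofRat K D)⁻¹ : GL (Fin t) K).val = y := by
      rw [← Matrix.GeneralLinearGroup.coe_mul, hy₀, mul_inv_cancel_right]
    have e4 : (ofRat K D : Matrix (Fin t) (Fin t) K) * (y₀⁻¹ : GL (Fin t) K).val =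
        (y⁻¹ : GL (Fin t) K).val := by
      rw [← Matrix.GeneralLinearGroup.coe_mul, hy₀, mul_inv_rev, mul_inv_cancel_left]
    ext i
    rcases i with i | i
    · simp only [f, coord, Sum.elim_inl]
      rw [hN, hd, e1, Matrix.smul_mul, e3, Matrix.smul_apply, smul_eq_mul]
      field_simp
    · simp only [f, coord, Sum.elim_inr]
      rw [hN', hd, e2, Matrix.mul_smul, e4, Matrix.smul_apply, smul_eq_mul]
      field_simp
  obtain ⟨x, hx1, hx2⟩ := hBK.exists_lieParam
    (mul_mem hg (ofRat_mem_isometryGroup hD)) hdet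
  obtain ⟨h1, h2⟩ := hcoord g (fun q => x q.1 q.2) hx1 hx2
  rw [← h1]
  refine (IsRegularAway.eval_comp hf p).eq_zero (fun x hx => ?_) _ h2
  rw [hd] at hx
  let b : Matrix (Fin t) (Fin t) ℚ := lieParam B ε (Matrix.of fun i j => x (i, j))
  have hb : (algebraMap ℚ K).mapMatrix b = a fun i => (x i : K) := by
    rw [map_lieParam]
    rfl
  have hb1 : (1 + b).det ≠ 0 := by
    intro h0
    apply left_ne_zero_of_mul hx
    rw [← hb, ← map_one (algebraMap ℚ K).mapMatrix, ← map_add, ← RingHom.map_det, h0, map_zero]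
  -- At a rational parameter the Cayley transform `y` is a rational isometry, hence so is `y * D⁻¹`,
  -- where `p` vanishes by hypothesis.
  obtain ⟨y, hy, hyb⟩ := hB.exists_cayley (hB.lieParam_skew _) hb1
  have := (hcoord (ofRat K (y * D⁻¹)) (fun i => (x i : K)) (left_ne_zero_of_mul hx) (by
    rw [← map_mul, inv_mul_cancel_right, ← hb, ← map_one (algebraMap ℚ K).mapMatrix, ← map_add,
      ← map_sub, ← hyb, map_mul]
    rfl)).1
  change MvPolynomial.eval (f fun i => (x i : K)) p = 0
  rw [this]
  exact hp _ (mul_mem hy (inv_mem hD))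

end Cayley

/-! ### Density of rational points for all four families -/

section Forms

variable {t : ℕ}

theorem isClassicalForm_one : IsClassicalForm (1 : Matrix (Fin t) (Fin t) ℚ) 1 (-2) where
  transpose_eq := by simp
  sign_sq := by norm_num
  transpose_mul_self := by simp
  reflection i := by norm_num
  ne_zero := by norm_num

theorem isClassicalForm_omega (ht : 0 < t) (he : Even t) : IsClassicalForm (omega t ℚ) (-1) 1 where
  transpose_eq := by
    ext i j
    obtain ⟨l, rfl⟩ := he
    simp only [omega, Matrix.transpose_apply, Matrix.of_apply, Matrix.smul_apply, smul_eq_mul]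
    split_ifs <;> first | omega | norm_num
  sign_sq := by norm_num
  transpose_mul_self := by
    obtain ⟨l, rfl⟩ := he
    ext i j
    have hl : (l + l) / 2 = l := by omega
    simp only [omega, Matrix.mul_apply, Matrix.transpose_apply, Matrix.of_apply, hl]
    by_cases hi : (i : ℕ) < l
    · rw [Finset.sum_eq_single (⟨i + l, by omega⟩ : Fin (l + l))]
      · simp only [Matrix.one_apply, Fin.ext_iff]
        split_ifs <;> first | omega | norm_num
      · intro b _ hb
        rw [ne_eq, Fin.ext_iff] at hb
        simp only at hb
        split_ifs <;> first | omega | norm_num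
      · simp
    · rw [Finset.sum_eq_single (⟨i - l, by omega⟩ : Fin (l + l))]
      · simp only [Matrix.one_apply, Fin.ext_iff]
        split_ifs <;> first | omega | norm_num
      · intro b _ hb
        rw [ne_eq, Fin.ext_iff] at hb
        simp only at hb
        split_ifs <;> first | omega | norm_num
      · simp
  reflection i := by
    have : omega t ℚ i i = 0 := by
      obtain ⟨l, rfl⟩ := he
      simp only [omega, Matrix.of_apply]
      split_ifs <;> first | omega | norm_num
    rw [this]
    norm_num
  ne_zero := by norm_num

theorem map_omega (K : Type*) [Field K] [CharZero K] :
    (omega t ℚ).map (algebraMap ℚ K) = omega t K := by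
  ext i j
  simp only [omega, Matrix.map_apply, Matrix.of_apply]
  split_ifs <;> simp

theorem rationalPointsDense (F : Family) (ht : 0 < t) (hF : F = .symplectic → Even t)
    (K : Type*) [Field K] [CharZero K] : RationalPointsDense F t K := by
  cases F with
  | general => exact rationalPointsDense_general
  | special => exact rationalPointsDense_special ht
  | orthogonal =>
    intro p hp g hg
    refine isClassicalForm_one.eval_eq_zero p hp g ?_
    rw [Matrix.map_one _ (map_zero _) (map_one _)]
    exact hg
  | symplectic =>
    intro p hp g hg
    refine (isClassicalForm_omega ht (hF rfl)).eval_eq_zero p hp g ?_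
    rw [map_omega]
    exact hg

end Forms

/-! ### Zariski density of the compact form -/

section Polar

variable {t : ℕ}

/-- The diagonal matrix with entries `exp (z μᵢ)`. -/
def expDiagonal (μ : Fin t → ℝ) (z : ℂ) : GL (Fin t) ℂ :=
  ⟨Matrix.diagonal fun i => Complex.exp (z * μ i), Matrix.diagonal fun i => Complex.exp (-z * μ i),
    by simp [Matrix.diagonal_mul_diagonal, ← Complex.exp_add],
    by simp [Matrix.diagonal_mul_diagonal, ← Complex.exp_add]⟩

theorem coe_expDiagonal (μ : Fin t → ℝ) (z : ℂ) : (expDiagonal μ z : Matrix (Fin t) (Fin t) ℂ) =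
    Matrix.diagonal fun i => Complex.exp (z * μ i) := rfl

theorem expDiagonal_add (μ : Fin t → ℝ) (z w : ℂ) :
    expDiagonal μ (z + w) = expDiagonal μ z * expDiagonal μ w := by
  apply Units.ext
  rw [Units.val_mul, coe_expDiagonal, coe_expDiagonal, coe_expDiagonal,
    Matrix.diagonal_mul_diagonal]
  congr 1
  ext i
  rw [← Complex.exp_add, add_mul]

theorem star_expDiagonal (μ : Fin t → ℝ) (z : ℂ) :
    star (expDiagonal μ z) = expDiagonal μ (starRingEnd ℂ z) := by
  apply Units.ext
  rw [Units.coe_star, coe_expDiagonal, coe_expDiagonal, Matrix.star_eq_conjTranspose,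
    Matrix.diagonal_conjTranspose]
  congr 1
  ext i
  simp [← Complex.exp_conj]

/-- The complex powers `V diag(exp (z μᵢ)) V⁻¹` of a positive definite matrix. -/
def hermitianPow (V : Matrix.unitaryGroup (Fin t) ℂ) (μ : Fin t → ℝ) (z : ℂ) : GL (Fin t) ℂ :=
  Unitary.toUnits V * expDiagonal μ z * (Unitary.toUnits V)⁻¹

variable (V : Matrix.unitaryGroup (Fin t) ℂ) (μ : Fin t → ℝ)

theorem hermitianPow_add (z w : ℂ) :
    hermitianPow V μ (z + w) = hermitianPow V μ z * hermitianPow V μ w := by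
  rw [hermitianPow, hermitianPow, hermitianPow, expDiagonal_add]
  group

theorem hermitianPow_zero : hermitianPow V μ 0 = 1 := by
  have := hermitianPow_add V μ 0 0
  rwa [add_zero, left_eq_mul] at this

theorem hermitianPow_neg (z : ℂ) : hermitianPow V μ (-z) = (hermitianPow V μ z)⁻¹ := by
  rw [eq_inv_iff_mul_eq_one, ← hermitianPow_add, neg_add_cancel, hermitianPow_zero]

theorem star_toUnits : star (Unitary.toUnits V) = (Unitary.toUnits V)⁻¹ :=
  Units.ext rfl

theorem star_hermitianPow (z : ℂ) :
    star (hermitianPow V μ z) = hermitianPow V μ (starRingEnd ℂ z) := by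
  rw [hermitianPow, star_mul, star_mul, star_inv, star_toUnits, star_expDiagonal, inv_inv,
    hermitianPow, mul_assoc]

open scoped ComplexOrder in
theorem exists_hermitianPow_eq (M : GL (Fin t) ℂ) :
    ∃ (V : Matrix.unitaryGroup (Fin t) ℂ) (μ : Fin t → ℝ), star M * M = hermitianPow V μ 1 := by
  have hpos : (M.val.conjTranspose * M.val).PosDef := by
    refine Matrix.PosDef.conjTranspose_mul_self _ ?_
    exact Matrix.mulVec_injective_of_isUnit M.isUnit
  refine ⟨hpos.isHermitian.eigenvectorUnitary,
    fun i => Real.log (hpos.isHermitian.eigenvalues i), ?_⟩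
  apply Units.ext
  change M.val.conjTranspose * M.val = _
  conv_lhs => rw [hpos.isHermitian.spectral_theorem]
  rw [Unitary.conjStarAlgAut_apply]
  change _ = (hpos.isHermitian.eigenvectorUnitary : Matrix (Fin t) (Fin t) ℂ) *
    (Matrix.diagonal fun i => Complex.exp (1 * (Real.log (hpos.isHermitian.eigenvalues i) : ℝ))) *
    star (hpos.isHermitian.eigenvectorUnitary : Matrix (Fin t) (Fin t) ℂ)
  congr 3
  ext i
  rw [one_mul, ← Complex.ofReal_exp, Real.exp_log (hpos.eigenvalues_pos i)]
  rfl

/-- In the eigenbasis the condition says `exp (z (μᵢ + μⱼ)) = 1` whenever the form has a nonzero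
entry at `(i, j)`. For `z = 1` and real `μ` this forces `μᵢ + μⱼ = 0`, and then it holds for every
`z`. -/
theorem hermitianPow_mem_isometryGroup {B : Matrix (Fin t) (Fin t) ℂ}
    (h : hermitianPow V μ 1 ∈ isometryGroup B) (z : ℂ) : hermitianPow V μ z ∈ isometryGroup B := by
  set W : GL (Fin t) ℂ := Unitary.toUnits V with hW
  set X : Matrix (Fin t) (Fin t) ℂ := W.val.transpose * B * W.val with hX
  have h1 : W.val * (W⁻¹ : GL (Fin t) ℂ).val = 1 := W.mul_inv
  have h2 : (W⁻¹ : GL (Fin t) ℂ).val * W.val = 1 := W.inv_mul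
  have h1' : (W⁻¹ : GL (Fin t) ℂ).val.transpose * W.val.transpose = 1 := by
    rw [← Matrix.transpose_mul, h1, Matrix.transpose_one]
  have h2' : W.val.transpose * (W⁻¹ : GL (Fin t) ℂ).val.transpose = 1 := by
    rw [← Matrix.transpose_mul, h2, Matrix.transpose_one]
  have key : ∀ z, hermitianPow V μ z ∈ isometryGroup B ↔
      ∀ i j, Complex.exp (z * (μ i + μ j)) * X i j = X i j := by
    intro z
    set D := (expDiagonal μ z).val with hD
    have hcoe : (hermitianPow V μ z).val = W.val * D * (W⁻¹ : GL (Fin t) ℂ).val := rfl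
    have e1 : D * X * D = X ↔ ∀ i j, Complex.exp (z * (μ i + μ j)) * X i j = X i j := by
      rw [← Matrix.ext_iff]
      refine forall_congr' fun i => forall_congr' fun j => ?_
      rw [hD, coe_expDiagonal, Matrix.mul_diagonal, Matrix.diagonal_mul, mul_add, Complex.exp_add,
        mul_right_comm]
    have hDt : D.transpose = D := Matrix.diagonal_transpose _
    rw [← e1, mem_isometryGroup, hcoe]
    have e2 : (W.val * D * (W⁻¹ : GL (Fin t) ℂ).val).transpose * B *
        (W.val * D * (W⁻¹ : GL (Fin t) ℂ).val) =
          (W⁻¹ : GL (Fin t) ℂ).val.transpose * (D * X * D) * (W⁻¹ : GL (Fin t) ℂ).val := by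
      simp only [Matrix.transpose_mul, hDt, hX, Matrix.mul_assoc]
    have e3 : B = (W⁻¹ : GL (Fin t) ℂ).val.transpose * X * (W⁻¹ : GL (Fin t) ℂ).val := by
      rw [hX, Matrix.mul_assoc W.val.transpose, ← Matrix.mul_assoc _ W.val.transpose, h1',
        Matrix.one_mul, Matrix.mul_assoc, h1, Matrix.mul_one]
    have e4 : ∀ Y, X = W.val.transpose * ((W⁻¹ : GL (Fin t) ℂ).val.transpose * Y *
        (W⁻¹ : GL (Fin t) ℂ).val) * W.val ↔ X = Y := by
      intro Y
      rw [Matrix.mul_assoc _ Y, ← Matrix.mul_assoc W.val.transpose, h2', Matrix.one_mul,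
        Matrix.mul_assoc, h2, Matrix.mul_one]
    rw [e2]
    constructor
    · intro h
      exact ((e4 _).mp (by rw [h])).symm
    · intro h
      rw [h, ← e3]
  rw [key] at h ⊢
  intro i j
  have hij := h i j
  by_cases hXij : X i j = 0
  · rw [hXij, mul_zero]
  · have h3 : Complex.exp (1 * (μ i + μ j)) = 1 := by
      have := sub_eq_zero.mpr hij
      rw [← sub_one_mul] at this
      exact sub_eq_zero.mp ((mul_eq_zero.mp this).resolve_right hXij)
    have h4 : μ i + μ j = 0 := by
      rw [one_mul, ← Complex.ofReal_add, ← Complex.ofReal_exp] at h3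
      exact Real.exp_eq_one_iff _ |>.mp (by exact_mod_cast h3)
    rw [← Complex.ofReal_add, h4]
    simp

theorem hermitianPow_mem_special (h : hermitianPow V μ 1 ∈ classicalGroup .special t ℂ) (z : ℂ) :
    hermitianPow V μ z ∈ classicalGroup .special t ℂ := by
  have key : ∀ z, hermitianPow V μ z ∈ classicalGroup .special t ℂ ↔
      Complex.exp (z * (∑ i, μ i : ℝ)) = 1 := by
    intro z
    change _ ∈ MonoidHom.ker _ ↔ _
    rw [MonoidHom.mem_ker, hermitianPow, map_mul, map_mul, map_inv, mul_right_comm, mul_inv_cancel,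
      one_mul, Units.ext_iff]
    change (expDiagonal μ z).val.det = 1 ↔ _
    rw [coe_expDiagonal, Matrix.det_diagonal, ← Complex.exp_sum, ← Finset.mul_sum,
      Complex.ofReal_sum]
  rw [key] at h ⊢
  have : ∑ i, μ i = 0 := by
    rw [one_mul, ← Complex.ofReal_exp] at h
    exact Real.exp_eq_one_iff _ |>.mp (by exact_mod_cast h)
  rw [this]
  simp

/-- Since `Bᵗ` is inverse to `B`, the relation `Mᵗ B M = B` implies `M B Mᵗ = B`; conjugating
entries, with `B` real, gives the claim. -/
theorem star_mem_isometryGroup {B : Matrix (Fin t) (Fin t) ℚ} {ε c : ℚ}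
    (hB : IsClassicalForm B ε c) {M : GL (Fin t) ℂ}
    (hM : M ∈ isometryGroup (B.map (algebraMap ℚ ℂ))) :
    star M ∈ isometryGroup (B.map (algebraMap ℚ ℂ)) := by
  have hB' := hB.map (algebraMap ℚ ℂ)
  set BC := B.map (algebraMap ℚ ℂ) with hBC
  rw [mem_isometryGroup] at hM ⊢
  have h1 : M.val * (BC.transpose * M.val.transpose * BC) = 1 := by
    apply mul_eq_one_comm.mp
    rw [Matrix.mul_assoc, Matrix.mul_assoc, ← Matrix.mul_assoc M.val.transpose, hM,
      hB'.transpose_mul_self]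
  have h2 : M.val * BC.transpose * M.val.transpose = BC.transpose := by
    have := congrArg (· * BC.transpose) h1
    simp only [Matrix.one_mul, Matrix.mul_assoc, hB'.mul_transpose_self, Matrix.mul_one] at this
    rw [Matrix.mul_assoc, this]
  have h3 : M.val * BC * M.val.transpose = BC := by
    have := congrArg Matrix.transpose h2
    rwa [Matrix.transpose_mul, Matrix.transpose_mul, Matrix.transpose_transpose,
      Matrix.transpose_transpose, ← Matrix.mul_assoc] at this
  have h4 : BC.map (starRingEnd ℂ) = BC := by
    ext i j
    simp [hBC]
  have h5 := congrArg (fun A => A.map (starRingEnd ℂ)) h3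
  simp only [Matrix.map_mul, h4] at h5
  exact h5

theorem star_mem_classicalGroup {F : Family} (ht : 0 < t) (hF : F = .symplectic → Even t)
    {M : GL (Fin t) ℂ} (hM : M ∈ classicalGroup F t ℂ) : star M ∈ classicalGroup F t ℂ := by
  cases F with
  | general => exact Subgroup.mem_top _
  | special =>
    change _ ∈ MonoidHom.ker _
    have h : M.val.det = 1 := congrArg Units.val hM
    rw [MonoidHom.mem_ker, Units.ext_iff]
    change M.val.conjTranspose.det = 1
    rw [Matrix.det_conjTranspose, h, star_one]
  | orthogonal =>
    have := @star_mem_isometryGroup t _ _ _ isClassicalForm_one M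
    rw [Matrix.map_one _ (map_zero _) (map_one _)] at this
    exact this hM
  | symplectic =>
    have := @star_mem_isometryGroup t _ _ _ (isClassicalForm_omega ht (hF rfl)) M
    rw [map_omega] at this
    exact this hM

theorem hermitianPow_mem_classicalGroup {F : Family}
    (h : hermitianPow V μ 1 ∈ classicalGroup F t ℂ) (z : ℂ) :
    hermitianPow V μ z ∈ classicalGroup F t ℂ := by
  cases F with
  | general => exact Subgroup.mem_top _
  | special => exact hermitianPow_mem_special V μ h z
  | orthogonal => exact hermitianPow_mem_isometryGroup V μ h z
  | symplectic => exact hermitianPow_mem_isometryGroup V μ h z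

theorem differentiable_entry_expDiagonal (A C : Matrix (Fin t) (Fin t) ℂ) (i j : Fin t) :
    Differentiable ℂ fun z => (A * (expDiagonal μ z).val * C) i j := by
  simp only [coe_expDiagonal, Matrix.mul_apply (N := C), Matrix.mul_diagonal]
  fun_prop

theorem differentiable_eval_coord (U : GL (Fin t) ℂ) (p : MvPolynomial (Idx t) ℂ) :
    Differentiable ℂ fun z => MvPolynomial.eval (coord (U * hermitianPow V μ z)) p := by
  have hc : ∀ i, Differentiable ℂ fun z => coord (U * hermitianPow V μ z) i := by
    rintro (i | i)
    · have := differentiable_entry_expDiagonal μ (U * Unitary.toUnits V : GL (Fin t) ℂ).val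
        ((Unitary.toUnits V)⁻¹ : GL (Fin t) ℂ).val i.1 i.2
      convert this using 2
      rw [← Units.val_mul, ← Units.val_mul, mul_assoc U, mul_assoc U]
      rfl
    · have h := (differentiable_entry_expDiagonal μ (Unitary.toUnits V : GL (Fin t) ℂ).val
        ((Unitary.toUnits V)⁻¹ * U⁻¹ : GL (Fin t) ℂ).val i.2 i.1).comp differentiable_neg
      have e : (fun z => coord (U * hermitianPow V μ z) (Sum.inr i)) =
          (fun z => ((Unitary.toUnits V : GL (Fin t) ℂ).val * (expDiagonal μ z).val *
            ((Unitary.toUnits V)⁻¹ * U⁻¹ : GL (Fin t) ℂ).val) i.2 i.1) ∘ Neg.neg := by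
        funext z
        simp only [coord, Sum.elim_inr, mul_inv_rev, ← hermitianPow_neg, Function.comp_apply]
        rw [← Units.val_mul, ← Units.val_mul, ← mul_assoc]
        rfl
      rw [e]
      exact h
  induction p using MvPolynomial.induction_on with
  | C a => simp
  | add p q hp hq => simp only [map_add]; exact hp.add hq
  | mul_X p i hp => simp only [map_mul, MvPolynomial.eval_X]; exact hp.mul (hc i)

/-- The coordinates of an element of the compact form. -/
def compactCoord {F : Family} (g : compactForm F t) : Idx t → ℂ :=
  coord (Unitary.toUnits (g : Matrix.unitaryGroup (Fin t) ℂ))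

/-- A polynomial function vanishing on `C` vanishes on `G(ℂ)`. -/
theorem compactForm_dense {F : Family} (ht : 0 < t) (hF : F = .symplectic → Even t)
    (p : MvPolynomial (Idx t) ℂ)
    (hp : ∀ g : compactForm F t, MvPolynomial.eval (compactCoord g) p = 0)
    (M : GL (Fin t) ℂ) (hM : M ∈ classicalGroup F t ℂ) : MvPolynomial.eval (coord M) p = 0 := by
  obtain ⟨V, μ, hP⟩ := exists_hermitianPow_eq M
  have hpow := hermitianPow_mem_classicalGroup V μ
    (hP ▸ mul_mem (star_mem_classicalGroup ht hF hM) hM)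
  -- The unitary factor of the polar decomposition `M = U P^(1/2)`, where `P = M* M`.
  set U : GL (Fin t) ℂ := M * hermitianPow V μ (-(1 / 2)) with hU
  have hUm : U ∈ classicalGroup F t ℂ := mul_mem hM (hpow _)
  have hUU : star U * U = 1 := by
    rw [hU, star_mul, star_hermitianPow, mul_assoc, ← mul_assoc (star M), hP, ← hermitianPow_add,
      ← hermitianPow_add]
    have : (starRingEnd ℂ) (-(1 / 2)) + (1 + -(1 / 2)) = 0 := by
      rw [map_neg, map_div₀, map_one, map_ofNat]
      norm_num
    rw [this, hermitianPow_zero]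
  have himag : ∀ s : ℝ, MvPolynomial.eval (coord (U * hermitianPow V μ (s * Complex.I))) p = 0 := by
    intro s
    set N := U * hermitianPow V μ (s * Complex.I) with hN
    have hNN : star N * N = 1 := by
      rw [hN, star_mul, star_hermitianPow, mul_assoc, ← mul_assoc (star U), hUU, one_mul,
        ← hermitianPow_add]
      have : (starRingEnd ℂ) (s * Complex.I) + s * Complex.I = 0 := by
        simp
      rw [this, hermitianPow_zero]
    have hNu : N.val ∈ Matrix.unitaryGroup (Fin t) ℂ :=
      Matrix.mem_unitaryGroup_iff'.mpr (congrArg Units.val hNN)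
    have hunits : Unitary.toUnits (⟨N.val, hNu⟩ : Matrix.unitaryGroup (Fin t) ℂ) = N :=
      Units.ext rfl
    have hNm : (⟨N.val, hNu⟩ : Matrix.unitaryGroup (Fin t) ℂ) ∈ compactForm F t := by
      rw [compactForm, Subgroup.mem_comap, hunits]
      exact mul_mem hUm (hpow _)
    have := hp ⟨_, hNm⟩
    rwa [compactCoord, hunits] at this
  -- The entire function `z ↦ p (U P^z)` vanishes on the imaginary axis, hence everywhere; at `z =
  -- 1/2` its argument is `M`.
  have hzero := AnalyticOnNhd.eqOn_zero_of_preconnected_of_frequently_eq_zero (z₀ := 0)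
    ((differentiable_eval_coord V μ U p).differentiableOn.analyticOnNhd isOpen_univ)
    isPreconnected_univ (Set.mem_univ _) (by
      have htend : Filter.Tendsto (fun s : ℝ => (s : ℂ) * Complex.I)
          (nhdsWithin 0 {0}ᶜ) (nhdsWithin 0 {0}ᶜ) := by
        refine tendsto_nhdsWithin_of_tendsto_nhds_of_eventually_within _ ?_ ?_
        · have : Continuous fun s : ℝ => (s : ℂ) * Complex.I := by fun_prop
          simpa using (this.tendsto 0).mono_left nhdsWithin_le_nhds
        · filter_upwards [self_mem_nhdsWithin] with s hs
          simpa using hs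
      exact htend.frequently (Filter.Eventually.of_forall himag).frequently)
  have := hzero (Set.mem_univ (1 / 2))
  simp only [Pi.zero_apply] at this
  rwa [hU, mul_assoc, ← hermitianPow_add, neg_add_cancel, hermitianPow_zero, mul_one] at this

end Polar

/-! ### Integration over the compact form -/

section Haar

instance haarC_isHaarMeasure (F : Family) (t : ℕ) : (haarC F t).IsHaarMeasure :=
  Measure.isHaarMeasure_haarMeasure _

instance haarC_isProbabilityMeasure (F : Family) (t : ℕ) : IsProbabilityMeasure (haarC F t) :=
  ⟨Measure.haarMeasure_self (K₀ := (⊤ : TopologicalSpace.PositiveCompacts (compactForm F t)))⟩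

/-- A right translate of the Haar measure is again a Haar probability measure, and that measure is
unique. -/
instance haarC_isMulRightInvariant (F : Family) (t : ℕ) : (haarC F t).IsMulRightInvariant where
  map_mul_right_eq_self g := by
    have : IsProbabilityMeasure ((haarC F t).map (· * g)) :=
      Measure.isProbabilityMeasure_map (by fun_prop)
    exact Measure.isHaarMeasure_eq_of_isProbabilityMeasure _ _

end Haar

section Integral

variable {F : Family} {t : ℕ}

theorem compactCoord_mul (g h : compactForm F t) : compactCoord (g * h) =
    coord (Unitary.toUnits (g : Matrix.unitaryGroup (Fin t) ℂ) *
      Unitary.toUnits (h : Matrix.unitaryGroup (Fin t) ℂ) : GL (Fin t) ℂ) := by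
  rw [compactCoord, Subgroup.coe_mul, map_mul]

theorem continuous_entry (i j : Fin t) : Continuous fun g : compactForm F t => entry g i j := by
  have h : Continuous fun g : compactForm F t =>
      ((g : Matrix.unitaryGroup (Fin t) ℂ) : Matrix (Fin t) (Fin t) ℂ) :=
    continuous_subtype_val.comp continuous_subtype_val
  exact h.matrix_elem i j

theorem continuous_aeval_compactCoord (p : MvPolynomial (Idx t) ℚ) :
    Continuous fun g : compactForm F t => MvPolynomial.aeval (compactCoord g) p := by
  induction p using MvPolynomial.induction_on with
  | C a => simpa using continuous_const
  | add p q hp hq => simp only [map_add]; exact hp.add hq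
  | mul_X p i hp =>
    simp only [map_mul, MvPolynomial.aeval_X]
    refine hp.mul ?_
    rcases i with i | i
    · exact continuous_entry i.1 i.2
    · exact Complex.continuous_conj.comp (continuous_entry i.1 i.2)

theorem integrable_aeval_compactCoord (p : MvPolynomial (Idx t) ℚ) :
    Integrable (fun g : compactForm F t => MvPolynomial.aeval (compactCoord g) p) (haarC F t) :=
  (continuous_aeval_compactCoord p).integrable_of_hasCompactSupport
    (HasCompactSupport.of_compactSpace _)

variable (F t) in
/-- The integral over the compact form of a rational polynomial in the entries of a matrix and
their complex conjugates. -/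
def compactIntegral : MvPolynomial (Idx t) ℚ →ₗ[ℚ] ℂ where
  toFun p := ∫ g, MvPolynomial.aeval (compactCoord g) p ∂(haarC F t)
  map_add' p q := by
    simp only [map_add]
    exact integral_add (integrable_aeval_compactCoord p) (integrable_aeval_compactCoord q)
  map_smul' r p := by
    simp only [map_smul]
    exact integral_smul r _

theorem compactIntegral_apply (p : MvPolynomial (Idx t) ℚ) : compactIntegral F t p =
    ∫ g, MvPolynomial.aeval (compactCoord g) p ∂(haarC F t) := rfl

theorem compactIntegral_C (r : ℚ) : compactIntegral F t (MvPolynomial.C r) = (r : ℂ) := by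
  simp [compactIntegral_apply]

/-- For a unitary matrix the inverse transpose is the entrywise conjugate, so the second block of
coordinates is `ū`. -/
theorem compactIntegral_monomial (K : Idx t →₀ ℕ) :
    compactIntegral F t (MvPolynomial.monomial K 1) = mixedMonomialIntegral F t K := by
  rw [compactIntegral_apply, mixedMonomialIntegral]
  congr 1
  ext g
  rw [MvPolynomial.aeval_monomial, map_one, one_mul, Finsupp.prod_fintype _ _ (by simp),
    Fintype.prod_sum_type]
  rfl

end Integral

/-! ### Comultiplication -/

section Comul

open scoped TensorProduct

variable {t : ℕ}

/-- The comultiplication dual to matrix multiplication. -/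
def comul (t : ℕ) : MvPolynomial (Idx t) ℚ →ₐ[ℚ]
    MvPolynomial (Idx t) ℚ ⊗[ℚ] MvPolynomial (Idx t) ℚ :=
  MvPolynomial.aeval (Sum.elim
    (fun p => ∑ l, MvPolynomial.X (Sum.inl (p.1, l)) ⊗ₜ MvPolynomial.X (Sum.inl (l, p.2)))
    (fun p => ∑ l, MvPolynomial.X (Sum.inr (p.1, l)) ⊗ₜ MvPolynomial.X (Sum.inr (l, p.2))))

theorem productMap_comul {K : Type*} [Field K] [CharZero K] (g h : GL (Fin t) K)
    (q : MvPolynomial (Idx t) ℚ) :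
    Algebra.TensorProduct.productMap (MvPolynomial.aeval (coord g))
      (MvPolynomial.aeval (coord h)) (comul t q) = MvPolynomial.aeval (coord (g * h)) q := by
  rw [← AlgHom.comp_apply]
  congr 1
  refine MvPolynomial.algHom_ext fun i => ?_
  rcases i with i | i
  · simp only [comul, AlgHom.comp_apply, MvPolynomial.aeval_X, Sum.elim_inl, map_sum,
      Algebra.TensorProduct.productMap_apply_tmul]
    rfl
  · simp only [comul, AlgHom.comp_apply, MvPolynomial.aeval_X, Sum.elim_inr, map_sum,
      Algebra.TensorProduct.productMap_apply_tmul, coord, mul_inv_rev, Units.val_mul,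
      Matrix.mul_apply, mul_comm]

/-- `q (gh) = ∑ a (g) b (h)`, the sum being over the pairs `(a, b)` in `S`. -/
def IsSplitting (q : MvPolynomial (Idx t) ℚ)
    (S : Finset (MvPolynomial (Idx t) ℚ × MvPolynomial (Idx t) ℚ)) : Prop :=
  comul t q = ∑ s ∈ S, s.1 ⊗ₜ s.2

theorem exists_isSplitting (q : MvPolynomial (Idx t) ℚ) : ∃ S, IsSplitting q S :=
  TensorProduct.exists_finset _

theorem IsSplitting.aeval_mul {q : MvPolynomial (Idx t) ℚ}
    {S : Finset (MvPolynomial (Idx t) ℚ × MvPolynomial (Idx t) ℚ)} (hS : IsSplitting q S)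
    {K : Type*} [Field K] [CharZero K] (g h : GL (Fin t) K) :
    MvPolynomial.aeval (coord (g * h)) q =
      ∑ s ∈ S, MvPolynomial.aeval (coord g) s.1 * MvPolynomial.aeval (coord h) s.2 := by
  rw [← productMap_comul, hS, map_sum]
  simp only [Algebra.TensorProduct.productMap_apply_tmul]

end Comul

/-! ### Rationality of the integrals -/

section Rationality

variable {F : Family} {t : ℕ}

theorem ofRat_mem_classicalGroup (hF : F = .symplectic → Even t) (K : Type*) [Field K] [CharZero K]
    {g : GL (Fin t) ℚ} (hg : g ∈ classicalGroup F t ℚ) : ofRat K g ∈ classicalGroup F t K := by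
  cases F with
  | general => exact Subgroup.mem_top _
  | special =>
    change _ ∈ MonoidHom.ker _
    have h : Matrix.GeneralLinearGroup.det g = 1 := hg
    rw [MonoidHom.mem_ker, ofRat, Matrix.GeneralLinearGroup.map_det, h, map_one]
  | orthogonal =>
    have := ofRat_mem_isometryGroup (K := K) hg
    rwa [Matrix.map_one _ (map_zero _) (map_one _)] at this
  | symplectic =>
    have := ofRat_mem_isometryGroup (K := K) hg
    rwa [map_omega] at this

theorem aeval_coord_ofRat (K : Type*) [Field K] [CharZero K] (g : GL (Fin t) ℚ)
    (p : MvPolynomial (Idx t) ℚ) : MvPolynomial.aeval (coord (ofRat K g)) p =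
      ((MvPolynomial.eval (coord g) p : ℚ) : K) := by
  rw [← eval_coord_ofRat, MvPolynomial.eval_map]
  rfl

theorem aeval_coord_eq_zero (ht : 0 < t) (hF : F = .symplectic → Even t) (K : Type*) [Field K]
    [CharZero K] (p : MvPolynomial (Idx t) ℚ)
    (hp : ∀ g ∈ classicalGroup F t ℚ, MvPolynomial.eval (coord g) p = 0) (g : GL (Fin t) K)
    (hg : g ∈ classicalGroup F t K) : MvPolynomial.aeval (coord g) p = 0 := by
  have := rationalPointsDense F ht hF K (MvPolynomial.map (algebraMap ℚ K) p)
    (fun g hg => by rw [eval_coord_ofRat, hp g hg, Rat.cast_zero]) g hg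
  rwa [MvPolynomial.eval_map] at this

theorem compactIntegral_eq_zero (ht : 0 < t) (hF : F = .symplectic → Even t)
    (p : MvPolynomial (Idx t) ℚ)
    (hp : ∀ g ∈ classicalGroup F t ℚ, MvPolynomial.eval (coord g) p = 0) :
    compactIntegral F t p = 0 := by
  rw [compactIntegral_apply, ← integral_zero _ _]
  congr 1
  ext g
  exact aeval_coord_eq_zero ht hF ℂ p hp _ g.2

theorem compactForm_dense_sum (ht : 0 < t) (hF : F = .symplectic → Even t) {α : Type*}
    (S : Finset α) (z : α → ℂ) (a : α → MvPolynomial (Idx t) ℚ) (w : ℂ)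
    (h : ∀ g : compactForm F t, ∑ s ∈ S, z s * MvPolynomial.aeval (compactCoord g) (a s) = w)
    (g : GL (Fin t) ℂ) (hg : g ∈ classicalGroup F t ℂ) :
    ∑ s ∈ S, z s * MvPolynomial.aeval (coord g) (a s) = w := by
  have key : ∀ x : Idx t → ℂ, MvPolynomial.eval x (∑ s ∈ S, MvPolynomial.C (z s) *
      MvPolynomial.map (algebraMap ℚ ℂ) (a s) - MvPolynomial.C w) =
        ∑ s ∈ S, z s * MvPolynomial.aeval x (a s) - w := by
    intro x
    rw [map_sub, map_sum, MvPolynomial.eval_C]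
    simp only [map_mul, MvPolynomial.eval_C, MvPolynomial.eval_map]
    rfl
  have := compactForm_dense ht hF _ (fun g => by rw [key, h g, sub_self]) g hg
  rwa [key, sub_eq_zero] at this

variable {q : MvPolynomial (Idx t) ℚ}
  {S : Finset (MvPolynomial (Idx t) ℚ × MvPolynomial (Idx t) ℚ)}

/-- For `g` in `C` this is left invariance of Haar measure, expanded as `∫ q (g h) dh = ∑ a (g) ∫
b`. Both sides are polynomial in `g`, so density of `C` extends it to `G(ℂ)`, in particular to
rational points. -/
theorem IsSplitting.sum_compactIntegral_snd (ht : 0 < t) (hF : F = .symplectic → Even t)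
    (hS : IsSplitting q S) (g : GL (Fin t) ℂ) (hg : g ∈ classicalGroup F t ℂ) :
    ∑ s ∈ S, compactIntegral F t s.2 * MvPolynomial.aeval (coord g) s.1 =
      compactIntegral F t q := by
  refine compactForm_dense_sum ht hF S _ _ _ (fun g => ?_) g hg
  rw [compactIntegral_apply q, ← integral_mul_left_eq_self _ g]
  simp only [compactCoord_mul, hS.aeval_mul]
  rw [integral_finsetSum]
  · refine Finset.sum_congr rfl fun s _ => ?_
    rw [integral_const_mul, mul_comm]
    rfl
  · intro s _
    exact (integrable_aeval_compactCoord s.2).const_mul _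

theorem IsSplitting.sum_compactIntegral_fst (ht : 0 < t) (hF : F = .symplectic → Even t)
    (hS : IsSplitting q S) (g : GL (Fin t) ℂ) (hg : g ∈ classicalGroup F t ℂ) :
    ∑ s ∈ S, compactIntegral F t s.1 * MvPolynomial.aeval (coord g) s.2 =
      compactIntegral F t q := by
  refine compactForm_dense_sum ht hF S _ _ _ (fun g => ?_) g hg
  rw [compactIntegral_apply q, ← integral_mul_right_eq_self _ g]
  simp only [compactCoord_mul, hS.aeval_mul]
  rw [integral_finsetSum]
  · refine Finset.sum_congr rfl fun s _ => ?_
    rw [integral_mul_const]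
    rfl
  · intro s _
    exact (integrable_aeval_compactCoord s.1).mul_const _

theorem compactIntegral_sum_eq (ht : 0 < t) (hF : F = .symplectic → Even t) {α : Type*}
    (S : Finset α) (z : α → ℚ) (a : α → MvPolynomial (Idx t) ℚ) (w : ℚ)
    (h : ∀ g ∈ classicalGroup F t ℚ, ∑ s ∈ S, z s * MvPolynomial.eval (coord g) (a s) = w) :
    ∑ s ∈ S, z s • compactIntegral F t (a s) = (w : ℂ) := by
  have := compactIntegral_eq_zero ht hF (∑ s ∈ S, z s • a s - MvPolynomial.C w) fun g hg => by
    rw [map_sub, map_sum, MvPolynomial.eval_C, ← h g hg]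
    simp
  rw [map_sub, map_sum, compactIntegral_C, sub_eq_zero] at this
  simpa only [map_smul] using this

theorem IsSplitting.sum_dual_snd (ht : 0 < t) (hF : F = .symplectic → Even t)
    (hS : IsSplitting q S) (e : ℂ →ₗ[ℚ] ℚ) (g : GL (Fin t) ℚ) (hg : g ∈ classicalGroup F t ℚ) :
    ∑ s ∈ S, e (compactIntegral F t s.2) * MvPolynomial.eval (coord g) s.1 =
      e (compactIntegral F t q) := by
  rw [← hS.sum_compactIntegral_snd ht hF _ (ofRat_mem_classicalGroup hF ℂ hg), map_sum]
  refine Finset.sum_congr rfl fun s _ => ?_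
  rw [aeval_coord_ofRat]
  exact (map_mul_algebraMap e _ _).symm

theorem IsSplitting.sum_dual_fst (ht : 0 < t) (hF : F = .symplectic → Even t)
    (hS : IsSplitting q S) (e : ℂ →ₗ[ℚ] ℚ) (g : GL (Fin t) ℚ) (hg : g ∈ classicalGroup F t ℚ) :
    ∑ s ∈ S, e (compactIntegral F t s.1) * MvPolynomial.eval (coord g) s.2 =
      e (compactIntegral F t q) := by
  rw [← hS.sum_compactIntegral_fst ht hF _ (ofRat_mem_classicalGroup hF ℂ hg), map_sum]
  refine Finset.sum_congr rfl fun s _ => ?_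
  rw [aeval_coord_ofRat]
  exact (map_mul_algebraMap e _ _).symm

/-- Write `I` for the integral and `q (g h) = ∑ a (g) b (h)`. Left invariance, pushed through `e` on
rational points and integrated again, gives `∑ e (I b) I a = e (I q)`. Right invariance, pushed
through an arbitrary `ξ : ℂ → ℚ`, integrated and then hit with `e`, gives `∑ ξ (I a) e (I b) = ξ (I
q)`. Hence `ξ (e (I q)) = ξ (I q)` for all `ξ`. -/
theorem dual_compactIntegral_eq (ht : 0 < t) (hF : F = .symplectic → Even t)
    (e : ℂ →ₗ[ℚ] ℚ) (he : e 1 = 1) (q : MvPolynomial (Idx t) ℚ) :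
    (e (compactIntegral F t q) : ℂ) = compactIntegral F t q := by
  have he' : ∀ r : ℚ, e (r : ℂ) = r := by
    intro r
    have := e.map_smul r 1
    rwa [he, smul_eq_mul, mul_one, Rat.smul_one_eq_cast] at this
  obtain ⟨S, hS⟩ := exists_isSplitting q
  rw [← compactIntegral_sum_eq ht hF S (fun s => e (compactIntegral F t s.2)) (fun s => s.1) _
    (hS.sum_dual_snd ht hF e)]
  refine eq_of_forall_dual (k := ℚ) fun ξ => ?_
  have h1 := congrArg e (compactIntegral_sum_eq ht hF S (fun s => ξ (compactIntegral F t s.1))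
    (fun s => s.2) _ (hS.sum_dual_fst ht hF ξ))
  rw [he', map_sum] at h1
  rw [← h1, map_sum]
  refine Finset.sum_congr rfl fun s _ => ?_
  rw [map_smul, map_smul, smul_eq_mul, smul_eq_mul, mul_comm]

/-- The integrals over the compact form of rational polynomials are rational. -/
theorem exists_rat_compactIntegral (ht : 0 < t) (hF : F = .symplectic → Even t) :
    ∃ L : MvPolynomial (Idx t) ℚ →ₗ[ℚ] ℚ, ∀ q, (L q : ℂ) = compactIntegral F t q := by
  obtain ⟨e, he⟩ := Module.Projective.exists_dual_ne_zero ℚ (one_ne_zero : (1 : ℂ) ≠ 0)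
  refine ⟨((e 1)⁻¹ • e) ∘ₗ compactIntegral F t, fun q => ?_⟩
  -- Rescaling makes the functional fix `1`, as the normalisation requires.
  exact dual_compactIntegral_eq ht hF ((e 1)⁻¹ • e) (by simp [he]) q

end Rationality

/-! ### Transfer of the invariant integral to the field `k` -/

section Invariance

variable {F : Family} {t : ℕ} {k : Type*} [Field k] [CharZero k]
  {L : MvPolynomial (Idx t) ℚ →ₗ[ℚ] ℚ}

theorem integrate_map (L : MvPolynomial (Idx t) ℚ →ₗ[ℚ] ℚ) (p : MvPolynomial (Idx t) ℚ) :
    integrate (fun I => L (MvPolynomial.monomial I 1)) k k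
      (MvPolynomial.map (algebraMap ℚ k) p) = (L p : k) := by
  induction p using MvPolynomial.induction_on' with
  | monomial I a =>
    have h : MvPolynomial.monomial I a = a • MvPolynomial.monomial I (1 : ℚ) := by
      rw [MvPolynomial.smul_monomial, smul_eq_mul, mul_one]
    rw [MvPolynomial.map_monomial, integrate_monomial, h, map_smul]
    simp
  | add p q hp hq => rw [map_add, map_add, map_add, hp, hq, Rat.cast_add]

theorem integrate_rat (c : (Idx t →₀ ℕ) → ℚ) (p : MvPolynomial (Idx t) k) :
    integrate c ℚ k p = integrate c k k p := by
  rw [integrate_apply, integrate_apply]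
  simp

theorem sum_mul_aeval_eq (ht : 0 < t) (hF : F = .symplectic → Even t) {α : Type*}
    (S : Finset α) (z : α → ℚ) (a : α → MvPolynomial (Idx t) ℚ) (w : ℚ)
    (h : ∀ g ∈ classicalGroup F t ℚ, ∑ s ∈ S, z s * MvPolynomial.eval (coord g) (a s) = w)
    (g : GL (Fin t) k) (hg : g ∈ classicalGroup F t k) :
    ∑ s ∈ S, (z s : k) * MvPolynomial.aeval (coord g) (a s) = w := by
  have := aeval_coord_eq_zero ht hF k (∑ s ∈ S, z s • a s - MvPolynomial.C w) (fun g hg => by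
    rw [map_sub, map_sum, MvPolynomial.eval_C, ← h g hg]
    simp) g hg
  rw [map_sub, map_sum, MvPolynomial.aeval_C, sub_eq_zero] at this
  simpa [Rat.smul_def] using this

theorem exists_translate_of_monomial {v : GL (Fin t) k → GL (Fin t) k}
    {c : (Idx t →₀ ℕ) → ℚ}
    (h : ∀ I : Idx t →₀ ℕ, ∃ p : MvPolynomial (Idx t) k,
      (∀ x, MvPolynomial.eval (coord x) p =
        MvPolynomial.aeval (coord (v x)) (MvPolynomial.monomial I (1 : ℚ))) ∧
      integrate c k k p = c I) (p : MvPolynomial (Idx t) k) :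
    ∃ p', (∀ x, MvPolynomial.eval (coord x) p' = MvPolynomial.eval (coord (v x)) p) ∧
      integrate c k k p' = integrate c k k p := by
  induction p using MvPolynomial.induction_on' with
  | monomial I a =>
    obtain ⟨p, h1, h2⟩ := h I
    refine ⟨a • p, fun x => ?_, ?_⟩
    · rw [MvPolynomial.smul_eval, h1, MvPolynomial.aeval_monomial, MvPolynomial.eval_monomial,
        map_one, one_mul]
    · rw [map_smul, h2, integrate_monomial]
      rfl
  | add p q hp hq =>
    obtain ⟨p', h1, h2⟩ := hp
    obtain ⟨q', h3, h4⟩ := hq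
    exact ⟨p' + q', fun x => by rw [map_add, map_add, h1, h3], by rw [map_add, map_add, h2, h4]⟩

theorem isInvariantIntegral (ht : 0 < t) (hF : F = .symplectic → Even t)
    (hL : ∀ q, (L q : ℂ) = compactIntegral F t q) :
    IsInvariantIntegral (fun g : classicalGroup F t k => coord (g : GL (Fin t) k))
      fun I => L (MvPolynomial.monomial I 1) := by
  have hLe : ∀ e : ℂ →ₗ[ℚ] ℚ, e 1 = 1 → ∀ q, e (compactIntegral F t q) = L q := by
    intro e he q
    have := dual_compactIntegral_eq ht hF e he q
    rw [← hL q] at this ⊢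
    exact_mod_cast this
  obtain ⟨e, he⟩ : ∃ e : ℂ →ₗ[ℚ] ℚ, e 1 = 1 := by
    obtain ⟨e, he⟩ := Module.Projective.exists_dual_ne_zero ℚ (one_ne_zero : (1 : ℂ) ≠ 0)
    exact ⟨(e 1)⁻¹ • e, by simp [he]⟩
  set c : (Idx t →₀ ℕ) → ℚ := fun I => L (MvPolynomial.monomial I 1) with hc
  have hvanish : ∀ p : MvPolynomial (Idx t) k,
      (∀ g : classicalGroup F t k, MvPolynomial.eval (coord (g : GL (Fin t) k)) p = 0) →
        integrate c k k p = 0 := by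
    intro p hp
    -- A `ℚ`-linear `ξ : k → ℚ` applied to the coefficients of `p` gives a rational polynomial
    -- vanishing on `G(ℚ)`, whose integral over `C` is zero.
    refine eq_of_forall_dual (k := ℚ) fun ξ => ?_
    rw [← integrate_rat, map_integrate, map_zero]
    have h1 : compactIntegral F t (mapCoeff ξ.toAddMonoidHom p) = 0 := by
      refine compactIntegral_eq_zero ht hF _ fun g hg => ?_
      have h2 := map_eval_algebraMap ξ p (coord g)
      have h3 : (fun i => algebraMap ℚ k (coord g i)) = coord (ofRat k g) := by
        ext i
        rw [coord_ofRat]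
        rfl
      rw [h3, hp ⟨_, ofRat_mem_classicalGroup hF k hg⟩, map_zero] at h2
      exact h2.symm
    have h4 := integrate_map (k := ℚ) L (mapCoeff ξ.toAddMonoidHom p)
    have hid : ∀ (f : ℚ →+* ℚ) (x : MvPolynomial (Idx t) ℚ), MvPolynomial.map f x = x := by
      intro f x
      rw [Subsingleton.elim f (RingHom.id ℚ), MvPolynomial.map_id]
    rw [hid] at h4
    rw [h4]
    have h5 := hL (mapCoeff ξ.toAddMonoidHom p)
    rw [h1] at h5
    exact_mod_cast h5
  -- Any `q` agreeing on `G(k)` with a translate of `p` may be replaced by one explicit translate,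
  -- by `hvanish`; by linearity it is enough to translate monomials.
  have htrans : ∀ (v : classicalGroup F t k → GL (Fin t) k → GL (Fin t) k)
      (g : classicalGroup F t k) (p q : MvPolynomial (Idx t) k),
      (∀ I : Idx t →₀ ℕ, ∃ p : MvPolynomial (Idx t) k,
        (∀ x, MvPolynomial.eval (coord x) p =
          MvPolynomial.aeval (coord (v g x)) (MvPolynomial.monomial I (1 : ℚ))) ∧
        integrate c k k p = c I) →
      (∀ h : classicalGroup F t k, MvPolynomial.eval (coord (h : GL (Fin t) k)) q =
        MvPolynomial.eval (coord (v g h)) p) → integrate c k k q = integrate c k k p := by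
    intro v g p q hI h
    obtain ⟨p', h1, h2⟩ := exists_translate_of_monomial hI p
    rw [← h2, ← sub_eq_zero, ← map_sub]
    refine hvanish _ fun x => ?_
    rw [map_sub, h, h1, sub_self]
  refine ⟨?_, hvanish, fun g p q h => ?_, fun g p q h => ?_⟩
  · have := hL (MvPolynomial.C 1)
    rw [compactIntegral_C] at this
    exact_mod_cast this
  · refine htrans (fun g x => g * x) g p q (fun I => ?_) h
    obtain ⟨S, hS⟩ := exists_isSplitting (MvPolynomial.monomial I (1 : ℚ))
    refine ⟨∑ s ∈ S, MvPolynomial.aeval (coord (g : GL (Fin t) k)) s.1 •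
      MvPolynomial.map (algebraMap ℚ k) s.2, fun x => ?_, ?_⟩
    · rw [hS.aeval_mul, map_sum]
      refine Finset.sum_congr rfl fun s _ => ?_
      rw [MvPolynomial.smul_eval, MvPolynomial.eval_map]
      rfl
    · rw [map_sum, hc]
      simp only [map_smul, integrate_map, smul_eq_mul]
      -- The invariance identity has rational coefficients and holds on `G(ℚ)`, so it holds at `g`
      -- in `G(k)` by density.
      rw [← sum_mul_aeval_eq ht hF S (fun s => L s.2) (fun s => s.1) _ (fun x hx => ?_) _ g.2]
      · exact Finset.sum_congr rfl fun s _ => mul_comm _ _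
      · have := hS.sum_dual_snd ht hF e x hx
        simpa only [hLe e he] using this
  · refine htrans (fun g x => x * g) g p q (fun I => ?_) h
    obtain ⟨S, hS⟩ := exists_isSplitting (MvPolynomial.monomial I (1 : ℚ))
    refine ⟨∑ s ∈ S, MvPolynomial.aeval (coord (g : GL (Fin t) k)) s.2 •
      MvPolynomial.map (algebraMap ℚ k) s.1, fun x => ?_, ?_⟩
    · rw [hS.aeval_mul, map_sum]
      refine Finset.sum_congr rfl fun s _ => ?_
      rw [MvPolynomial.smul_eval, MvPolynomial.eval_map, mul_comm]
      rfl
    · rw [map_sum, hc]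
      simp only [map_smul, integrate_map, smul_eq_mul]
      rw [← sum_mul_aeval_eq ht hF S (fun s => L s.1) (fun s => s.2) _ (fun x hx => ?_) _ g.2]
      · exact Finset.sum_congr rfl fun s _ => mul_comm _ _
      · have := hS.sum_dual_fst ht hF e x hx
        simpa only [hLe e he] using this

end Invariance

/-! ### The two actions -/

section Actions

variable {t : ℕ} {k : Type*} [Field k]

/-- Substitutions compose in reverse order: `Y ↦ g Y` followed by `Y ↦ h Y` yields `g h Y`. Thus
equivariance uses left translations, and invariance of the values right ones. -/
theorem stdAct_stdAct (n : ℕ) (g h : GL (Fin t) k) (f : PolyY t n k) :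
    stdAct t n h (stdAct t n g f) = stdAct t n (g * h) f := by
  suffices H : (stdAct t n h).comp (stdAct t n g) = stdAct t n (g * h) from
    DFunLike.congr_fun H f
  refine MvPolynomial.algHom_ext fun p => ?_
  simp only [AlgHom.comp_apply, stdAct, MvPolynomial.aeval_X, map_sum, map_mul,
    MvPolynomial.algHom_C, MvPolynomial.algebraMap_eq, Units.val_mul, Matrix.mul_apply,
    Finset.mul_sum, Finset.sum_mul]
  rw [Finset.sum_comm]
  simp only [mul_assoc]

theorem stdAct_eq_eval (n : ℕ) (g : GL (Fin t) k) (f : PolyY t n k) :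
    stdAct t n g f = MvPolynomial.eval
      (fun p => algebraMap k (PolyY t n k) (coord g (Sum.inl p))) (stdPhi t n k f) := by
  induction f using MvPolynomial.induction_on with
  | C a => simp [MvPolynomial.algebraMap_apply, MvPolynomial.algebraMap_eq]
  | add p q hp hq => rw [map_add, map_add, map_add, hp, hq]
  | mul_X p i hp =>
    rw [map_mul, map_mul, map_mul, hp]
    congr 1
    simp [stdAct, stdPhi, coord, MvPolynomial.algebraMap_eq]

theorem dualAct_dualAct (m n : ℕ) (g h : GL (Fin t) k) (f : PolyXY t m n k) :
    dualAct t m n h (dualAct t m n g f) = dualAct t m n (g * h) f := by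
  suffices H : (dualAct t m n h).comp (dualAct t m n g) = dualAct t m n (g * h) from
    DFunLike.congr_fun H f
  refine MvPolynomial.algHom_ext fun p => ?_
  rcases p with p | p
  · simp only [AlgHom.comp_apply, dualAct, MvPolynomial.aeval_X, Sum.elim_inl, map_sum, map_mul,
      MvPolynomial.algHom_C, MvPolynomial.algebraMap_eq, mul_inv_rev, Units.val_mul,
      Matrix.mul_apply, Finset.mul_sum, Finset.sum_mul]
    rw [Finset.sum_comm]
    simp only [mul_assoc]
  · simp only [AlgHom.comp_apply, dualAct, MvPolynomial.aeval_X, Sum.elim_inr, map_sum, map_mul,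
      MvPolynomial.algHom_C, MvPolynomial.algebraMap_eq, Units.val_mul, Matrix.mul_apply,
      Finset.mul_sum, Finset.sum_mul]
    rw [Finset.sum_comm]
    simp only [mul_assoc]

theorem dualAct_eq_eval (m n : ℕ) (g : GL (Fin t) k) (f : PolyXY t m n k) :
    dualAct t m n g f = MvPolynomial.eval
      (fun i => algebraMap k (PolyXY t m n k) (coord g i)) (dualPhi t m n k f) := by
  induction f using MvPolynomial.induction_on with
  | C a => simp [MvPolynomial.algebraMap_apply, MvPolynomial.algebraMap_eq]
  | add p q hp hq => rw [map_add, map_add, map_add, hp, hq]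
  | mul_X p i hp =>
    rw [map_mul, map_mul, map_mul, hp]
    congr 1
    rcases i with i | i
    · simp only [dualAct, dualPhi, coord, MvPolynomial.algebraMap_eq, MvPolynomial.aeval_X,
        Sum.elim_inl, Sum.elim_inr, map_sum, map_mul, MvPolynomial.eval_C, MvPolynomial.eval_X]
    · simp only [dualAct, dualPhi, coord, MvPolynomial.algebraMap_eq, MvPolynomial.aeval_X,
        Sum.elim_inl, Sum.elim_inr, map_sum, map_mul, MvPolynomial.eval_C, MvPolynomial.eval_X]

theorem mixedMonomialIntegral_mapDomain (F : Family) (I : Fin t × Fin t →₀ ℕ) :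
    mixedMonomialIntegral F t (I.mapDomain Sum.inl) = monomialIntegral F t I := by
  rw [mixedMonomialIntegral, monomialIntegral]
  congr 1
  ext g
  have h1 : ∀ p, I.mapDomain (Sum.inl : _ → Idx t) (Sum.inl p) = I p :=
    fun p => Finsupp.mapDomain_apply Sum.inl_injective _ _
  have h2 : ∀ p, I.mapDomain (Sum.inl : _ → Idx t) (Sum.inr p) = 0 :=
    fun p => Finsupp.mapDomain_of_notMem_range _ _ (by simp)
  simp [h1, h2]

end Actions

end ReynoldsClassical

end

theorem mainTheorem7 (F : ReynoldsClassical.Family) (t : ℕ) (ht : 0 < t)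
    (hF : F = ReynoldsClassical.Family.symplectic → Even t)
    (k : Type*) [Field k] [CharZero k] :
    -- copies of the standard representation
    (∃ c : (Fin t × Fin t →₀ ℕ) → ℚ,
      (∀ I, ((c I : ℚ) : ℂ) = ReynoldsClassical.monomialIntegral F t I) ∧
      ∀ n : ℕ, 0 < n →
        ∃ R : ReynoldsClassical.PolyY t n k →ₗ[k] ReynoldsClassical.invariants
            (fun M : ReynoldsClassical.classicalGroup F t k =>
              ReynoldsClassical.stdAct t n (M : GL (Fin t) k)),
          ReynoldsClassical.IsReynoldsOperator _ R ∧
          (∀ R', ReynoldsClassical.IsReynoldsOperator _ R' → R' = R) ∧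
          ∀ f : ReynoldsClassical.PolyY t n k,
            (R f : ReynoldsClassical.PolyY t n k) =
              ∑ I ∈ (ReynoldsClassical.stdPhi t n k f).support,
                (ReynoldsClassical.stdPhi t n k f).coeff I *
                  MvPolynomial.C ((c I : ℚ) : k)) ∧
    -- copies of the standard and the dual representations
    (∃ c : ((Fin t × Fin t) ⊕ (Fin t × Fin t) →₀ ℕ) → ℚ,
      (∀ K, ((c K : ℚ) : ℂ) = ReynoldsClassical.mixedMonomialIntegral F t K) ∧
      ∀ m n : ℕ, 0 < m → 0 < n →
        ∃ R : ReynoldsClassical.PolyXY t m n k →ₗ[k] ReynoldsClassical.invariants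
            (fun M : ReynoldsClassical.classicalGroup F t k =>
              ReynoldsClassical.dualAct t m n (M : GL (Fin t) k)),
          ReynoldsClassical.IsReynoldsOperator _ R ∧
          (∀ R', ReynoldsClassical.IsReynoldsOperator _ R' → R' = R) ∧
          ∀ f : ReynoldsClassical.PolyXY t m n k,
            (R f : ReynoldsClassical.PolyXY t m n k) =
              ∑ K ∈ (ReynoldsClassical.dualPhi t m n k f).support,
                (ReynoldsClassical.dualPhi t m n k f).coeff K *
                  MvPolynomial.C ((c K : ℚ) : k)) := by
  obtain ⟨L, hL⟩ := ReynoldsClassical.exists_rat_compactIntegral ht hF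
  have hc := ReynoldsClassical.isInvariantIntegral (k := k) ht hF hL
  have hrat : ∀ K, ((L (MvPolynomial.monomial K 1) : ℚ) : ℂ) =
      ReynoldsClassical.mixedMonomialIntegral F t K := fun K => by
    rw [hL, ReynoldsClassical.compactIntegral_monomial]
  refine ⟨⟨fun I => L (MvPolynomial.monomial (I.mapDomain Sum.inl) 1), fun I => ?_,
    fun n _ => ?_⟩, ⟨fun K => L (MvPolynomial.monomial K 1), hrat, fun m n _ _ => ?_⟩⟩
  · rw [hrat, ReynoldsClassical.mixedMonomialIntegral_mapDomain]
  · obtain ⟨R, h1, h2, h3⟩ := (hc.comap Sum.inl).existsUnique_reynolds _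
      (ReynoldsClassical.stdPhi t n k)
      (fun g f => ReynoldsClassical.stdAct_eq_eval n (g : GL (Fin t) k) f)
      (fun g h f => ReynoldsClassical.stdAct_stdAct n (g : GL (Fin t) k) h f)
    exact ⟨R, h1, h2, fun f => (h3 f).trans (ReynoldsClassical.integrate_apply _ _)⟩
  · obtain ⟨R, h1, h2, h3⟩ := hc.existsUnique_reynolds _
      (ReynoldsClassical.dualPhi t m n k)
      (fun g f => ReynoldsClassical.dualAct_eq_eval m n (g : GL (Fin t) k) f)
      (fun g h f => ReynoldsClassical.dualAct_dualAct m n (g : GL (Fin t) k) h f)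
    exact ⟨R, h1, h2, fun f => (h3 f).trans (ReynoldsClassical.integrate_apply _ _)⟩
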